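/- **Theorem.** There is a randomized algorithm, consisting of a preprocessing phase and a matching phase, with the following property. Let $M$ be an $n\times n$ doubly stochastic matrix with $m$ nonzero entries, given by adjacency arrays: for each row, an array lists the nonzero entries of that row (column and value) in arbitrary order. The preprocessing phase takes $O(m)$ time. The matching phase, started from the memory left by the preprocessing, takes $O(n\log^2 n)$ expected time and outputs a perfect matching in the support of $M$, that is, in the bipartite graph between rows and columns whose edges are the positions of the nonzero entries of $M$. Time is the number of steps of a random-access machine with exact real arithmetic and fair coin tosses, and the constants in the $O$-bounds do not depend on $n$, $m$ or $M$. (For $n\le 1$, where $m$ or $n\log^2 n$ vanishes, the bounds are read as $O(m+1)$ and $O(n\log^2 n+1)$.) -/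

import Mathlib

open scoped ENNReal

/-! ### A randomized real random-access machine

A machine has finitely many integer variables, real variables, integer arrays and real arrays
(those that its program names). Integers are natural numbers and serve as counters, indices and
addresses; reals are exact. One step is one assignment, one test, one coin toss or one structural
move of the control. Expressions occur only inside a fixed program, so each of them stands for a
number of operations (constants, reads, `+`, `-`, halving) that does not depend on the input.
There is no multiplication, no rounding of reals, and no real constant besides `0` and `1`; the
only source of randomness is a fair coin. -/

namespace RandRAM

/-- Integer expressions. Subtraction is truncated at `0`, halving rounds down. -/
inductive IExp where
  | lit (k : ℕ)
  | var (x : ℕ)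
  | get (a : ℕ) (e : IExp)
  | add (e₁ e₂ : IExp)
  | sub (e₁ e₂ : IExp)
  | half (e : IExp)

/-- Real expressions; real arrays are addressed by integers. -/
inductive RExp where
  | zero
  | one
  | var (x : ℕ)
  | get (a : ℕ) (e : IExp)
  | add (e₁ e₂ : RExp)
  | sub (e₁ e₂ : RExp)

/-- Tests: comparisons of integers, comparisons of reals, and their Boolean combinations. -/
inductive Test where
  | ilt (e₁ e₂ : IExp)
  | ieq (e₁ e₂ : IExp)
  | rlt (e₁ e₂ : RExp)
  | not (b : Test)
  | and (b₁ b₂ : Test)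

/-- Programs. -/
inductive Cmd where
  | skip
  /-- integer variable `x := e` -/
  | iset (x : ℕ) (e : IExp)
  /-- integer array cell `a[i] := e` -/
  | iput (a : ℕ) (i e : IExp)
  /-- real variable `x := e` -/
  | rset (x : ℕ) (e : RExp)
  /-- real array cell `a[i] := e` -/
  | rput (a : ℕ) (i : IExp) (e : RExp)
  /-- toss a fair coin and store the outcome, `0` or `1`, in the integer variable `x` -/
  | flip (x : ℕ)
  | seq (p q : Cmd)
  | branch (b : Test) (p q : Cmd)
  /-- while `b` holds, execute `p` -/
  | loop (b : Test) (p : Cmd)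

/-- The contents of the memory. -/
@[ext]
structure State where
  ivar : ℕ → ℕ
  iarr : ℕ → ℕ → ℕ
  rvar : ℕ → ℝ
  rarr : ℕ → ℕ → ℝ

def IExp.eval (s : State) : IExp → ℕ
  | lit k => k
  | var x => s.ivar x
  | get a e => s.iarr a (e.eval s)
  | add e₁ e₂ => e₁.eval s + e₂.eval s
  | sub e₁ e₂ => e₁.eval s - e₂.eval s
  | half e => e.eval s / 2

noncomputable def RExp.eval (s : State) : RExp → ℝ
  | zero => 0
  | one => 1
  | var x => s.rvar x
  | get a e => s.rarr a (e.eval s)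
  | add e₁ e₂ => e₁.eval s + e₂.eval s
  | sub e₁ e₂ => e₁.eval s - e₂.eval s

def Test.Holds (s : State) : Test → Prop
  | ilt e₁ e₂ => e₁.eval s < e₂.eval s
  | ieq e₁ e₂ => e₁.eval s = e₂.eval s
  | rlt e₁ e₂ => e₁.eval s < e₂.eval s
  | not b => ¬ b.Holds s
  | and b₁ b₂ => b₁.Holds s ∧ b₂.Holds s

def State.setIVar (s : State) (x v : ℕ) : State :=
  { s with ivar := Function.update s.ivar x v }

def State.setIArr (s : State) (a i v : ℕ) : State :=
  { s with iarr := Function.update s.iarr a (Function.update (s.iarr a) i v) }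

noncomputable def State.setRVar (s : State) (x : ℕ) (v : ℝ) : State :=
  { s with rvar := Function.update s.rvar x v }

noncomputable def State.setRArr (s : State) (a i : ℕ) (v : ℝ) : State :=
  { s with rarr := Function.update s.rarr a (Function.update (s.rarr a) i v) }

/-- A configuration: the commands that are still to be executed, in order, and the memory. -/
@[ext]
structure Config where
  todo : List Cmd
  state : State

def Config.Halted (c : Config) : Prop := c.todo = []

open Classical in
/-- One step of the machine, as a probability distribution on the next configuration. A halted
machine stays as it is. -/
noncomputable def step (c : Config) : PMF Config :=
  let s := c.state
  match c.todo with
  | [] => PMF.pure c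
  | .skip :: K => PMF.pure ⟨K, s⟩
  | .iset x e :: K => PMF.pure ⟨K, s.setIVar x (e.eval s)⟩
  | .iput a i e :: K => PMF.pure ⟨K, s.setIArr a (i.eval s) (e.eval s)⟩
  | .rset x e :: K => PMF.pure ⟨K, s.setRVar x (e.eval s)⟩
  | .rput a i e :: K => PMF.pure ⟨K, s.setRArr a (i.eval s) (e.eval s)⟩
  | .flip x :: K => (PMF.uniformOfFintype Bool).map fun b => ⟨K, s.setIVar x b.toNat⟩
  | .seq p q :: K => PMF.pure ⟨p :: q :: K, s⟩
  | .branch b p q :: K => PMF.pure (if b.Holds s then ⟨p :: K, s⟩ else ⟨q :: K, s⟩)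
  | .loop b p :: K => PMF.pure (if b.Holds s then ⟨p :: .loop b p :: K, s⟩ else ⟨K, s⟩)

/-- The distribution of the configuration after `t` steps. -/
noncomputable def run : ℕ → Config → PMF Config
  | 0, c => PMF.pure c
  | t + 1, c => (step c).bind (run t)

/-- The expected number `𝔼[T] = ∑ₜ ℙ[T > t]` of steps until the machine halts; it is infinite if
the machine fails to halt with positive probability. -/
noncomputable def expectedTime (c : Config) : ℝ≥0∞ :=
  ∑' t : ℕ, (run t c).toOuterMeasure {c' | ¬ c'.Halted}

end RandRAM

/-! ### Sparse matrices, their bipartite graphs, and matchings -/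

/-- The number of nonzero entries. -/
noncomputable def numNonzero {n : ℕ} (M : Matrix (Fin n) (Fin n) ℝ) : ℕ :=
  {p : Fin n × Fin n | M p.1 p.2 ≠ 0}.ncard

/-- The arrays `ptr`, `col`, `wt` hold the adjacency arrays of the rows of `M`, one after the
other: the positions `ptr i ≤ k < ptr (i + 1)` list the nonzero entries of row `i`, each exactly
once and in an arbitrary order, `col k` being the column and `wt k` the value of the entry. -/
structure IsAdjacencyArray {n : ℕ} (M : Matrix (Fin n) (Fin n) ℝ)
    (ptr col : ℕ → ℕ) (wt : ℕ → ℝ) : Prop where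
  ptr_zero : ptr 0 = 0
  ptr_le : ∀ i < n, ptr i ≤ ptr (i + 1)
  entry : ∀ i : Fin n, ∀ k ∈ Set.Ico (ptr i) (ptr (i + 1)),
    ∃ j : Fin n, col k = j ∧ M i j ≠ 0 ∧ wt k = M i j
  injOn : ∀ i : Fin n, Set.InjOn col (Set.Ico (ptr i) (ptr (i + 1)))
  complete : ∀ i j : Fin n, M i j ≠ 0 → ∃ k ∈ Set.Ico (ptr i) (ptr (i + 1)), col k = j

/-- The memory that holds an input: the size in integer variable `0`, the adjacency arrays in
integer arrays `0` and `1` and real array `0`, and zeros everywhere else. -/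
noncomputable def inputState (n : ℕ) (ptr col : ℕ → ℕ) (wt : ℕ → ℝ) : RandRAM.State where
  ivar := Function.update 0 0 n
  iarr := Function.update (Function.update 0 0 ptr) 1 col
  rvar := 0
  rarr := Function.update 0 0 wt

/-- The bipartite graph between rows and columns whose edges are the nonzero entries of `M`. -/
def supportGraph {n : ℕ} (M : Matrix (Fin n) (Fin n) ℝ) : SimpleGraph (Fin n ⊕ Fin n) :=
  SimpleGraph.fromRel fun x y => ∃ i j, x = Sum.inl i ∧ y = Sum.inr j ∧ M i j ≠ 0

/-- The array `out`, read as "row `i` is matched to column `out i`", is a perfect matching in the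
support of `M`. -/
def IsPerfectMatchingOf {n : ℕ} (M : Matrix (Fin n) (Fin n) ℝ) (out : ℕ → ℕ) : Prop :=
  ∃ S : (supportGraph M).Subgraph, S.IsPerfectMatching ∧
    ∀ i j : Fin n, S.Adj (Sum.inl i) (Sum.inr j) ↔ out i = j

namespace RandRAM

/-! ### Expected running times -/

/-! The matching grows by augmentation. While `k` rows are unmatched, one of them is chosen
uniformly, and a random walk starts there: it goes from a row to a column with the probability given
by the matrix entry, stops if the column is unmatched, and otherwise continues from the row matched
to the column. Erasing the loops of the walk leaves an augmenting path.

The walks are short on average because the columns sum to one. Add up the expected lengths over all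
rows. The first moves contribute `n`. Each matched column is entered with total weight at most one,
so the remaining moves contribute at most the sum of the expected lengths over the matched rows.
Cancelling that sum leaves at most `n` for the unmatched rows together (`sum_walkTime_le`), hence `n
/ k` on average. Summed over `k` this is a harmonic sum of order `n log n`.

One move costs `O(log n)` expected time: `sample` does a binary search in the prefix sums left by
the preprocessing, and each of its decisions is a biased coin that `bernoulli` simulates with a
constant expected number of fair tosses. The prefix sums continue by unit increments past the
entries, so the same routine also picks the uniform starting row.

Times are bounded through the transformer `ert`, the expected number of steps plus the expected
value of a final function. Its loop rule `ert_loop_le` needs only an invariant and a potential. If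
the final function is infinite wherever the output is wrong (`require`), one finite bound gives both
the running time and the correctness of every reachable result (`post_of_ert_lt_top`). -/

/-- The expected value of `V`. -/
noncomputable def PMFExpect {α : Type*} (p : PMF α) (V : α → ℝ≥0∞) : ℝ≥0∞ := ∑' a, p a * V a

theorem PMFExpect_pure {α : Type*} (a : α) (V : α → ℝ≥0∞) : PMFExpect (PMF.pure a) V = V a := by
  classical
  rw [PMFExpect, tsum_eq_single a]
  · simp
  · intro b hb
    simp [PMF.pure_apply, hb]

theorem PMFExpect_bind {α β : Type*} (p : PMF α) (g : α → PMF β) (V : β → ℝ≥0∞) :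
    PMFExpect (p.bind g) V = PMFExpect p fun a => PMFExpect (g a) V := by
  simp only [PMFExpect, PMF.bind_apply, ← ENNReal.tsum_mul_right, ← ENNReal.tsum_mul_left]
  rw [ENNReal.tsum_comm]
  simp only [mul_assoc]

theorem PMFExpect_map {α β : Type*} (p : PMF α) (g : α → β) (V : β → ℝ≥0∞) :
    PMFExpect (p.map g) V = PMFExpect p (V ∘ g) := by
  rw [PMF.map, PMFExpect_bind]
  simp only [Function.comp_def, PMFExpect_pure]

theorem PMFExpect_mono {α : Type*} (p : PMF α) {V W : α → ℝ≥0∞} (h : ∀ a, V a ≤ W a) :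
    PMFExpect p V ≤ PMFExpect p W :=
  ENNReal.tsum_le_tsum fun a => mul_le_mul_right (h a) _

theorem PMFExpect_finset_sum {α ι : Type*} (p : PMF α) (s : Finset ι) (V : ι → α → ℝ≥0∞) :
    PMFExpect p (fun a => ∑ i ∈ s, V i a) = ∑ i ∈ s, PMFExpect p (V i) := by
  simp only [PMFExpect, Finset.mul_sum]
  exact Summable.tsum_finsetSum fun _ _ => ENNReal.summable

theorem PMFExpect_uniform_bool (V : Bool → ℝ≥0∞) :
    PMFExpect (PMF.uniformOfFintype Bool) V = (V false + V true) / 2 := by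
  rw [PMFExpect, tsum_fintype]
  simp only [PMF.uniformOfFintype_apply, Fintype.card_bool, Fintype.sum_bool, Nat.cast_ofNat]
  rw [← mul_add, add_comm, ENNReal.div_eq_inv_mul]

/-- The probability that a configuration reached after `t` steps is not halted. -/
theorem run_notHalted_succ (t : ℕ) (c : Config) :
    (run (t + 1) c).toOuterMeasure {c' | ¬ c'.Halted} =
      PMFExpect (step c) fun d => (run t d).toOuterMeasure {c' | ¬ c'.Halted} := by
  simp only [run, PMF.toOuterMeasure_bind_apply, PMFExpect]

open Classical in
theorem run_notHalted_zero (c : Config) :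
    (run 0 c).toOuterMeasure {c' | ¬ c'.Halted} = if c.Halted then 0 else 1 := by
  simp only [run, PMF.toOuterMeasure_pure_apply, Set.mem_ofPred_eq]
  by_cases h : c.Halted <;> simp [h]

open Classical in
/-- `V` decreases in expectation by at least one in every step before halting. -/
def IsPotential (V : Config → ℝ≥0∞) : Prop :=
  ∀ c, (if c.Halted then 0 else 1) + PMFExpect (step c) V ≤ V c

/-- Induction on the number of terms bounds every partial sum of the tail probabilities by `V c`:
the first term is paid by the drop of the potential in one step, the others by induction from the
next configuration. -/
theorem IsPotential.expectedTime_le {V : Config → ℝ≥0∞} (hV : IsPotential V) (c : Config) :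
    expectedTime c ≤ V c := by
  rw [expectedTime, ENNReal.tsum_eq_iSup_nat]
  refine iSup_le fun N => ?_
  induction N generalizing c with
  | zero => simp
  | succ N ih =>
    rw [Finset.sum_range_succ', add_comm, run_notHalted_zero]
    simp only [run_notHalted_succ]
    rw [← PMFExpect_finset_sum]
    exact (add_le_add le_rfl (PMFExpect_mono _ ih)).trans (hV c)

/-- A successor of positive probability and infinite potential would make the expectation, hence `V
c`, infinite. -/
theorem IsPotential.lt_top_of_mem_support {V : Config → ℝ≥0∞} (hV : IsPotential V) (t : ℕ)
    {c c' : Config} (hc : V c < ⊤) (hc' : c' ∈ (run t c).support) : V c' < ⊤ := by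
  induction t generalizing c with
  | zero =>
    simp only [run, PMF.support_pure, Set.mem_singleton_iff] at hc'
    exact hc' ▸ hc
  | succ t ih =>
    simp only [run, PMF.mem_support_bind_iff] at hc'
    obtain ⟨d, hd, hd'⟩ := hc'
    refine ih ?_ hd'
    have h1 : step c d * V d ≤ V c :=
      (ENNReal.le_tsum d).trans (le_add_self.trans (hV c))
    by_contra h
    rw [not_lt, top_le_iff] at h
    rw [h, ENNReal.mul_top ((PMF.mem_support_iff _ _).1 hd)] at h1
    exact absurd (h1.trans_lt hc) (lt_irrefl _)

/-! ### The running time transformer of programs -/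

open Classical in
/-- One unfolding of a loop with body `P` and test `b`. -/
noncomputable def loopStep (b : Test) (P : (State → ℝ≥0∞) →o (State → ℝ≥0∞)) (f : State → ℝ≥0∞) :
    (State → ℝ≥0∞) →o (State → ℝ≥0∞) where
  toFun X s := 1 + if b.Holds s then P X s else f s
  monotone' := by
    intro X Y h s
    refine add_le_add le_rfl ?_
    split_ifs
    exacts [P.monotone h s, le_rfl]

open Classical in
theorem loopStep_apply (b : Test) (P : (State → ℝ≥0∞) →o (State → ℝ≥0∞)) (f X : State → ℝ≥0∞)
    (s : State) : loopStep b P f X s = 1 + if b.Holds s then P X s else f s := rfl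

theorem loopStep_mono (b : Test) (P : (State → ℝ≥0∞) →o (State → ℝ≥0∞)) {f g : State → ℝ≥0∞}
    (h : f ≤ g) : loopStep b P f ≤ loopStep b P g := by
  classical
  intro X s
  rw [loopStep_apply, loopStep_apply]
  refine add_le_add le_rfl ?_
  split_ifs
  exacts [le_rfl, h s]

open Classical in
/-- The expected running time transformer: `ert p f s` is the expected value of the number of
steps of `p` started in `s` plus the value of `f` at the final state. -/
noncomputable def ert : Cmd → (State → ℝ≥0∞) →o (State → ℝ≥0∞)
  | .skip => ⟨fun f s => 1 + f s, fun _ _ h s => add_le_add le_rfl (h s)⟩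
  | .iset x e => ⟨fun f s => 1 + f (s.setIVar x (e.eval s)), fun _ _ h _ => add_le_add le_rfl (h _)⟩
  | .iput a i e => ⟨fun f s => 1 + f (s.setIArr a (i.eval s) (e.eval s)),
      fun _ _ h _ => add_le_add le_rfl (h _)⟩
  | .rset x e => ⟨fun f s => 1 + f (s.setRVar x (e.eval s)), fun _ _ h _ => add_le_add le_rfl (h _)⟩
  | .rput a i e => ⟨fun f s => 1 + f (s.setRArr a (i.eval s) (e.eval s)),
      fun _ _ h _ => add_le_add le_rfl (h _)⟩
  | .flip x => ⟨fun f s => 1 + (f (s.setIVar x 0) + f (s.setIVar x 1)) / 2,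
      fun _ _ h _ => add_le_add le_rfl (ENNReal.div_le_div_right (add_le_add (h _) (h _)) _)⟩
  | .seq p q => ⟨fun f s => 1 + ert p (ert q f) s,
      fun _ _ h s => add_le_add le_rfl ((ert p).monotone ((ert q).monotone h) s)⟩
  | .branch b p q => ⟨fun f s => 1 + if b.Holds s then ert p f s else ert q f s,
      fun _ _ h s => add_le_add le_rfl (by
        dsimp only
        split_ifs
        exacts [(ert p).monotone h s, (ert q).monotone h s])⟩
  | .loop b p => ⟨fun f => OrderHom.lfp (loopStep b (ert p) f),
      fun _ _ h => OrderHom.lfp.monotone (loopStep_mono b (ert p) h)⟩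

section
variable (f : State → ℝ≥0∞) (s : State)

theorem ert_skip : ert .skip f s = 1 + f s := by rw [ert]; rfl
theorem ert_iset (x : ℕ) (e : IExp) : ert (.iset x e) f s = 1 + f (s.setIVar x (e.eval s)) := by
  rw [ert]; rfl
theorem ert_iput (a : ℕ) (i e : IExp) :
    ert (.iput a i e) f s = 1 + f (s.setIArr a (i.eval s) (e.eval s)) := by rw [ert]; rfl
theorem ert_rset (x : ℕ) (e : RExp) : ert (.rset x e) f s = 1 + f (s.setRVar x (e.eval s)) := by
  rw [ert]; rfl
theorem ert_rput (a : ℕ) (i : IExp) (e : RExp) :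
    ert (.rput a i e) f s = 1 + f (s.setRArr a (i.eval s) (e.eval s)) := by rw [ert]; rfl
theorem ert_flip (x : ℕ) :
    ert (.flip x) f s = 1 + (f (s.setIVar x 0) + f (s.setIVar x 1)) / 2 := by rw [ert]; rfl
theorem ert_seq (p q : Cmd) : ert (.seq p q) f s = 1 + ert p (ert q f) s := by rw [ert]; rfl

open Classical in
theorem ert_branch (b : Test) (p q : Cmd) :
    ert (.branch b p q) f s = 1 + if b.Holds s then ert p f s else ert q f s := by rw [ert]; rfl

theorem ert_loop_eq_lfp (b : Test) (p : Cmd) :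
    ert (.loop b p) f = OrderHom.lfp (loopStep b (ert p) f) := by rw [ert]; rfl

open Classical in
theorem ert_loop (b : Test) (p : Cmd) :
    ert (.loop b p) f s = 1 + if b.Holds s then ert p (ert (.loop b p) f) s else f s := by
  rw [← loopStep_apply, ert_loop_eq_lfp, OrderHom.map_lfp]

end

/-- Loop rule: `Inv g s` is an invariant with an auxiliary value `g`, and `pot` bounds the expected
remaining time. -/
theorem ert_loop_le {γ : Type*} {b : Test} {p : Cmd} {f : State → ℝ≥0∞}
    (Inv : γ → State → Prop) (pot : γ → ℝ≥0∞)
    (hstep : ∀ g s, Inv g s → b.Holds s → ∀ X : State → ℝ≥0∞,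
      (∀ g' s', Inv g' s' → X s' ≤ pot g') → 1 + ert p X s ≤ pot g)
    (hend : ∀ g s, Inv g s → ¬ b.Holds s → 1 + f s ≤ pot g)
    {g : γ} {s : State} (h : Inv g s) : ert (.loop b p) f s ≤ pot g := by
  classical
  -- The infimum of `pot` over all auxiliary values admissible at `s` is a pre-fixed point of the
  -- unfolding, so the least fixed point lies below it.
  have key : ert (.loop b p) f ≤ fun s => ⨅ g, ⨅ _ : Inv g s, pot g := by
    rw [ert_loop_eq_lfp]
    refine OrderHom.lfp_le _ fun s => le_iInf₂ fun g hg => ?_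
    rw [loopStep_apply]
    split_ifs with hb
    · exact hstep g s hg hb _ fun g' s' h' => iInf₂_le g' h'
    · exact hend g s hg hb
  exact (key s).trans (iInf₂_le g h)

/-- The running time transformer of a list of commands. -/
noncomputable def ertList : List Cmd → (State → ℝ≥0∞) → State → ℝ≥0∞
  | [], f => f
  | p :: K, f => ert p (ertList K f)

/-- Each defining equation of `ert` accounts for exactly one machine step, so the transformer of the
commands still to be executed is a potential. -/
theorem isPotential_ertList (f : State → ℝ≥0∞) :
    IsPotential fun c => ertList c.todo f c.state := by
  classical
  rintro ⟨K, s⟩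
  match K with
  | [] => simp [Config.Halted, step, PMFExpect_pure, ertList]
  | .skip :: K => simp [Config.Halted, step, PMFExpect_pure, ertList, ert_skip]
  | .iset x e :: K => simp [Config.Halted, step, PMFExpect_pure, ertList, ert_iset]
  | .iput a i e :: K => simp [Config.Halted, step, PMFExpect_pure, ertList, ert_iput]
  | .rset x e :: K => simp [Config.Halted, step, PMFExpect_pure, ertList, ert_rset]
  | .rput a i e :: K => simp [Config.Halted, step, PMFExpect_pure, ertList, ert_rput]
  | .flip x :: K =>
    simp [Config.Halted, step, PMFExpect_map, PMFExpect_uniform_bool, ertList, ert_flip]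
  | .seq p q :: K => simp [Config.Halted, step, PMFExpect_pure, ertList, ert_seq]
  | .branch b p q :: K =>
    by_cases hb : b.Holds s <;>
      simp [Config.Halted, step, PMFExpect_pure, ertList, ert_branch, hb]
  | .loop b p :: K =>
    by_cases hb : b.Holds s
    · simp only [Config.Halted, step, PMFExpect_pure, hb]
      conv_rhs => rw [ertList, ert_loop]
      simp [hb, ertList]
    · simp only [Config.Halted, step, PMFExpect_pure, hb]
      conv_rhs => rw [ertList, ert_loop]
      simp [hb]

open Classical in
/-- The function that is `0` where `Q` holds and infinite elsewhere. -/
noncomputable def require (Q : State → Prop) (s : State) : ℝ≥0∞ := if Q s then 0 else ⊤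

theorem require_of {Q : State → Prop} {s : State} (h : Q s) : require Q s = 0 := if_pos h

theorem of_require_lt_top {Q : State → Prop} {s : State} (h : require Q s < ⊤) : Q s := by
  by_contra hQ
  simp [require, hQ] at h

theorem expectedTime_le_ert (p : Cmd) (f : State → ℝ≥0∞) (s : State) :
    expectedTime ⟨[p], s⟩ ≤ ert p f s :=
  (isPotential_ertList f).expectedTime_le ⟨[p], s⟩

/-- Finiteness of the potential propagates to reachable configurations, and in a halted one the
potential is `require Q` itself. -/
theorem post_of_ert_lt_top {p : Cmd} {Q : State → Prop} {s : State}
    (h : ert p (require Q) s < ⊤) {t : ℕ} {c : Config}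
    (hc : c ∈ (run t ⟨[p], s⟩).support) (hh : c.Halted) : Q c.state := by
  have := (isPotential_ertList (require Q)).lt_top_of_mem_support t (c := ⟨[p], s⟩) h hc
  rw [Config.Halted] at hh
  simp only [hh, ertList] at this
  exact of_require_lt_top this

/-! ### Deterministic programs -/

/-- Programs without coin tosses. -/
def Cmd.NoFlip : Cmd → Prop
  | .flip _ => False
  | .seq p q => p.NoFlip ∧ q.NoFlip
  | .branch _ p q => p.NoFlip ∧ q.NoFlip
  | .loop _ p => p.NoFlip
  | _ => True

theorem exists_step_eq_pure {c : Config} (h : ∀ p ∈ c.todo, p.NoFlip) :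
    ∃ d : Config, step c = PMF.pure d ∧ ∀ p ∈ d.todo, p.NoFlip := by
  classical
  obtain ⟨K, s⟩ := c
  match K with
  | [] => exact ⟨_, rfl, h⟩
  | .skip :: K => exact ⟨_, rfl, by simp_all⟩
  | .iset x e :: K => exact ⟨_, rfl, by simp_all⟩
  | .iput a i e :: K => exact ⟨_, rfl, by simp_all⟩
  | .rset x e :: K => exact ⟨_, rfl, by simp_all⟩
  | .rput a i e :: K => exact ⟨_, rfl, by simp_all⟩
  | .flip x :: K => simp [Cmd.NoFlip] at h
  | .seq p q :: K => exact ⟨_, rfl, by simp_all [Cmd.NoFlip]⟩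
  | .branch b p q :: K =>
    refine ⟨_, rfl, ?_⟩
    by_cases hb : b.Holds s <;> simp_all [Cmd.NoFlip]
  | .loop b p :: K =>
    refine ⟨_, rfl, ?_⟩
    by_cases hb : b.Holds s <;> simp_all [Cmd.NoFlip]

theorem exists_run_eq_pure (t : ℕ) {c : Config} (h : ∀ p ∈ c.todo, p.NoFlip) :
    ∃ d : Config, run t c = PMF.pure d := by
  induction t generalizing c with
  | zero => exact ⟨c, rfl⟩
  | succ t ih =>
    obtain ⟨d, hd, hd'⟩ := exists_step_eq_pure h
    obtain ⟨e, he⟩ := ih hd'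
    exact ⟨e, by rw [run, hd, PMF.pure_bind, he]⟩

theorem step_of_halted {c : Config} (h : c.Halted) : step c = PMF.pure c := by
  obtain ⟨K, s⟩ := c
  obtain rfl : K = [] := h
  rfl

theorem run_of_halted {c : Config} (h : c.Halted) (t : ℕ) : run t c = PMF.pure c := by
  induction t with
  | zero => rfl
  | succ t ih => rw [run, step_of_halted h, PMF.pure_bind, ih]

theorem run_add (t u : ℕ) (c : Config) : run (t + u) c = (run t c).bind (run u) := by
  induction t generalizing c with
  | zero => simp [run]
  | succ t ih =>
    rw [Nat.add_right_comm, run, run, PMF.bind_bind]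
    exact congrArg _ (funext ih)

/-- A program without coin tosses halts within its expected time. -/
theorem halted_of_noFlip {p : Cmd} (hp : p.NoFlip) {s : State} {N : ℕ}
    (h : expectedTime ⟨[p], s⟩ ≤ N) {c : Config} (hc : c ∈ (run N ⟨[p], s⟩).support) :
    c.Halted := by
  have hp' : ∀ q ∈ (⟨[p], s⟩ : Config).todo, q.NoFlip := by simpa using hp
  by_contra hcH
  -- The run is deterministic and a halted machine stays halted. If it is still running after `N`
  -- steps, the `N + 1` tail probabilities up to time `N` are all one, which exceeds the bound `N`.
  have hone : ∀ t ≤ N, (run t ⟨[p], s⟩).toOuterMeasure {c' | ¬ c'.Halted} = 1 := by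
    intro t ht
    obtain ⟨d, hd⟩ := exists_run_eq_pure t hp'
    have : ¬ d.Halted := by
      intro hdH
      obtain ⟨u, rfl⟩ := Nat.exists_eq_add_of_le ht
      rw [run_add, hd, PMF.pure_bind, run_of_halted hdH] at hc
      simp only [PMF.support_pure, Set.mem_singleton_iff] at hc
      exact hcH (hc ▸ hdH)
    classical
    rw [hd, PMF.toOuterMeasure_pure_apply]
    simp [this]
  have h1 : ∑ t ∈ Finset.range (N + 1), (run t ⟨[p], s⟩).toOuterMeasure {c' | ¬ c'.Halted} ≤ N :=
    (ENNReal.sum_le_tsum _).trans h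
  rw [Finset.sum_congr rfl fun t ht => hone t (by simpa [Nat.lt_succ_iff] using ht)] at h1
  simp only [Finset.sum_const, Finset.card_range, nsmul_eq_mul, mul_one] at h1
  have : N + 1 ≤ N := by exact_mod_cast h1
  omega

/-! ### Memory updates and frame conditions -/

@[simp] theorem ivar_setIVar (s : State) (x v y : ℕ) :
    (s.setIVar x v).ivar y = if y = x then v else s.ivar y := by
  simp [State.setIVar, Function.update_apply]
@[simp] theorem iarr_setIVar (s : State) (x v : ℕ) : (s.setIVar x v).iarr = s.iarr := rfl
@[simp] theorem rvar_setIVar (s : State) (x v : ℕ) : (s.setIVar x v).rvar = s.rvar := rfl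
@[simp] theorem rarr_setIVar (s : State) (x v : ℕ) : (s.setIVar x v).rarr = s.rarr := rfl
@[simp] theorem iarr_setIArr (s : State) (a i v b : ℕ) :
    (s.setIArr a i v).iarr b = if b = a then Function.update (s.iarr a) i v else s.iarr b := by
  simp [State.setIArr, Function.update_apply]
@[simp] theorem ivar_setIArr (s : State) (a i v : ℕ) : (s.setIArr a i v).ivar = s.ivar := rfl
@[simp] theorem rarr_setIArr (s : State) (a i v : ℕ) : (s.setIArr a i v).rarr = s.rarr := rfl
@[simp] theorem rvar_setRVar (s : State) (x : ℕ) (v : ℝ) (y : ℕ) :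
    (s.setRVar x v).rvar y = if y = x then v else s.rvar y := by
  simp [State.setRVar, Function.update_apply]
@[simp] theorem ivar_setRVar (s : State) (x : ℕ) (v : ℝ) : (s.setRVar x v).ivar = s.ivar := rfl
@[simp] theorem iarr_setRVar (s : State) (x : ℕ) (v : ℝ) : (s.setRVar x v).iarr = s.iarr := rfl
@[simp] theorem rarr_setRVar (s : State) (x : ℕ) (v : ℝ) : (s.setRVar x v).rarr = s.rarr := rfl
@[simp] theorem rarr_setRArr (s : State) (a i : ℕ) (v : ℝ) (b : ℕ) :
    (s.setRArr a i v).rarr b = if b = a then Function.update (s.rarr a) i v else s.rarr b := by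
  simp [State.setRArr, Function.update_apply]
@[simp] theorem ivar_setRArr (s : State) (a i : ℕ) (v : ℝ) : (s.setRArr a i v).ivar = s.ivar := rfl
@[simp] theorem iarr_setRArr (s : State) (a i : ℕ) (v : ℝ) : (s.setRArr a i v).iarr = s.iarr := rfl

/-- The states agree except for real variables and the integer variables in `V`. -/
structure Agree (V : Set ℕ) (s s' : State) : Prop where
  ivar : ∀ x ∉ V, s'.ivar x = s.ivar x
  iarr : s'.iarr = s.iarr
  rarr : s'.rarr = s.rarr

theorem Agree.refl (V : Set ℕ) (s : State) : Agree V s s := ⟨fun _ _ => rfl, rfl, rfl⟩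

theorem Agree.trans {V : Set ℕ} {s s' s'' : State} (h : Agree V s s') (h' : Agree V s' s'') :
    Agree V s s'' :=
  ⟨fun x hx => (h'.ivar x hx).trans (h.ivar x hx), h'.iarr.trans h.iarr, h'.rarr.trans h.rarr⟩

theorem Agree.mono {V W : Set ℕ} {s s' : State} (h : Agree V s s') (hVW : V ⊆ W) :
    Agree W s s' := ⟨fun x hx => h.ivar x fun hx' => hx (hVW hx'), h.iarr, h.rarr⟩

theorem Agree.setIVar {V : Set ℕ} {s s' : State} (h : Agree V s s') {x : ℕ} (hx : x ∈ V) (v : ℕ) :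
    Agree V s (s'.setIVar x v) :=
  ⟨fun y hy => by
    have : y ≠ x := fun e => hy (e ▸ hx)
    simp [this, h.ivar y hy], h.iarr, h.rarr⟩

theorem Agree.setRVar {V : Set ℕ} {s s' : State} (h : Agree V s s') (x : ℕ) (v : ℝ) :
    Agree V s (s'.setRVar x v) := ⟨h.ivar, h.iarr, h.rarr⟩

/-! ### A biased coin from fair coins -/

/-- With real variables `0` and `1` holding `a` and `T` and integer variable `7` holding `2`, set
integer variable `7` to `1` with probability `a / T` and to `0` otherwise, by comparing `a / T` with
a uniform random number that is revealed bit by bit. -/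
def bernoulli : Cmd :=
  .loop (.ieq (.var 7) (.lit 2))
    (.seq (.rset 0 (.add (.var 0) (.var 0)))
    (.seq (.flip 6)
      (.branch (.rlt (.var 0) (.var 1))
        (.branch (.ieq (.var 6) (.lit 1)) (.iset 7 (.lit 0)) .skip)
        (.seq (.rset 0 (.sub (.var 0) (.var 1)))
          (.branch (.ieq (.var 6) (.lit 0)) (.iset 7 (.lit 1)) .skip)))))

/-- The constant `21` solves `x = 10 + (1 + x) / 2`: a round costs at most ten steps, and then with
equal chances only the last loop test or another full game remains. -/
theorem half_step_le {p q F G : ℝ≥0∞} :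
    10 + ((1 + G) + (21 + p * F + q * G)) / 2 ≤ 21 + p * 2⁻¹ * F + (2⁻¹ + q * 2⁻¹) * G := by
  rw [ENNReal.div_eq_inv_mul]
  have h : (10 : ℝ≥0∞) + 2⁻¹ * 22 = 21 := by
    rw [show (22 : ℝ≥0∞) = 2 * 11 by norm_num, ← mul_assoc,
      ENNReal.inv_mul_cancel (by norm_num) (by norm_num)]
    norm_num
  calc 10 + 2⁻¹ * ((1 + G) + (21 + p * F + q * G))
      = (10 + 2⁻¹ * 22) + p * 2⁻¹ * F + (2⁻¹ + q * 2⁻¹) * G := by ring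
    _ ≤ _ := by rw [h]

theorem ofReal_half_mul (x : ℝ) : ENNReal.ofReal (x / 2) = ENNReal.ofReal x * 2⁻¹ := by
  rw [div_eq_mul_inv, ENNReal.ofReal_mul' (by norm_num), ENNReal.ofReal_inv_of_pos (by norm_num)]
  norm_num

theorem five_steps_average_le {x x' y y' : ℝ≥0∞} (hx : x ≤ x') (hy : y ≤ y') :
    (1 + (1 + (1 + (1 + (1 + x)))) + (1 + (1 + (1 + (1 + (1 + y)))))) / 2 ≤ 5 + (x' + y') / 2 := by
  rw [show 1 + (1 + (1 + (1 + (1 + x)))) + (1 + (1 + (1 + (1 + (1 + y))))) = 5 * 2 + (x + y) by ring,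
    ENNReal.add_div, ENNReal.mul_div_cancel_right (by norm_num) (by norm_num)]
  gcongr

theorem three_steps_average_le {x x' y y' : ℝ≥0∞} (hx : x ≤ x') (hy : y ≤ y') :
    (1 + (1 + (1 + x)) + (1 + (1 + (1 + y)))) / 2 ≤ 5 + (x' + y') / 2 := by
  refine le_trans ?_ (five_steps_average_le hx hy)
  refine ENNReal.div_le_div_right (add_le_add ?_ ?_) _ <;>
    exact le_add_self.trans le_add_self

theorem ert_bernoulli_le {f : State → ℝ≥0∞} {s : State} {F₀ F₁ : ℝ≥0∞} (h7 : s.ivar 7 = 2)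
    (h0 : 0 ≤ s.rvar 0) (h01 : s.rvar 0 ≤ s.rvar 1) (h1 : 0 < s.rvar 1)
    (hF₀ : ∀ s', Agree {6, 7} s s' → s'.ivar 7 = 0 → f s' ≤ F₀)
    (hF₁ : ∀ s', Agree {6, 7} s s' → s'.ivar 7 = 1 → f s' ≤ F₁) :
    ert bernoulli f s ≤ 21 + ENNReal.ofReal (s.rvar 0 / s.rvar 1) * F₁
      + ENNReal.ofReal (1 - s.rvar 0 / s.rvar 1) * F₀ := by
  set T := s.rvar 1 with hT
  -- `inl a` means that the toss is undecided and must still succeed with probability `a / T`; `inr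
  -- b` means that it is decided.
  let Inv : ℝ ⊕ Bool → State → Prop := fun g s' => Agree {6, 7} s s' ∧ match g with
    | .inl a => s'.ivar 7 = 2 ∧ s'.rvar 0 = a ∧ s'.rvar 1 = T ∧ 0 ≤ a ∧ a ≤ T
    | .inr b => s'.ivar 7 = b.toNat
  let pot : ℝ ⊕ Bool → ℝ≥0∞ := fun g => match g with
    | .inl a => 21 + ENNReal.ofReal (a / T) * F₁ + ENNReal.ofReal (1 - a / T) * F₀
    | .inr b => 1 + bif b then F₁ else F₀
  refine ert_loop_le Inv pot ?_ ?_ (g := .inl (s.rvar 0))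
    ⟨Agree.refl _ _, h7, rfl, rfl, h0, h01⟩
  · rintro (a | b) s' ⟨hA, hs⟩ hb X hX
    · obtain ⟨h7', ha, hT', ha0, haT⟩ := hs
      simp only [ert_seq, ert_rset, ert_flip, ert_branch, ert_iset, ert_skip, Test.Holds,
        RExp.eval, IExp.eval, rvar_setIVar, rvar_setRVar, ivar_setIVar, ha, hT']
      norm_num
      -- This determines the next binary digit of `a / T`. The toss is the same digit of the uniform
      -- number; the comparison is decided as soon as the two digits differ.
      by_cases hlt : a + a < T
      · simp only [hlt, if_true]
        have e1 := hX (.inl (a + a)) (((s'.setRVar 0 (a + a)).setIVar 6 0))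
          ⟨(hA.setRVar _ _).setIVar (by simp) _, by simp [h7', hT', ha0, hlt.le]⟩
        have e2 := hX (.inr false) (((s'.setRVar 0 (a + a)).setIVar 6 1).setIVar 7 0)
          ⟨((hA.setRVar _ _).setIVar (by simp) _).setIVar (by simp) _, by simp⟩
        simp only [pot, cond_false] at e1 e2
        have p1 : ENNReal.ofReal (a / T) = ENNReal.ofReal ((a + a) / T) * 2⁻¹ := by
          rw [← ofReal_half_mul]; congr 1; ring
        have p2 : ENNReal.ofReal (1 - a / T) = 2⁻¹ + ENNReal.ofReal (1 - (a + a) / T) * 2⁻¹ := by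
          have h2 : ENNReal.ofReal (1 / 2) = 2⁻¹ := by rw [ofReal_half_mul]; simp
          rw [← ofReal_half_mul, ← h2, ← ENNReal.ofReal_add (by norm_num)]
          · congr 1; ring
          · have : (a + a) / T ≤ 1 := (div_le_one h1).2 hlt.le
            linarith
        simp only [pot]
        rw [p1, p2]
        rw [show ∀ x : ℝ≥0∞, 1 + (1 + (1 + (1 + (1 + x)))) = 5 + x by intro x; ring]
        have h5 := three_steps_average_le e1 e2
        rw [add_comm _ (1 + F₀)] at h5
        refine (add_le_add le_rfl h5).trans (le_trans (le_of_eq ?_) half_step_le)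
        rw [← add_assoc, show (5 : ℝ≥0∞) + 5 = 10 by norm_num]
      · simp only [hlt, if_false]
        have hle := not_lt.1 hlt
        have e1 := hX (.inr true) ((((s'.setRVar 0 (a + a)).setIVar 6 0).setRVar 0
            (a + a - T)).setIVar 7 1)
          ⟨((((hA.setRVar _ _).setIVar (by simp) _).setRVar _ _).setIVar (by simp) _), by simp⟩
        have e2 := hX (.inl (a + a - T)) ((((s'.setRVar 0 (a + a)).setIVar 6 1)).setRVar 0
            (a + a - T))
          ⟨((hA.setRVar _ _).setIVar (by simp) _).setRVar _ _, by simp [h7', hT', hle]; linarith⟩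
        simp only [pot, cond_true] at e1 e2
        have h2 : ENNReal.ofReal (1 / 2) = 2⁻¹ := by rw [ofReal_half_mul]; simp
        have p2 : ENNReal.ofReal (1 - a / T) =
            ENNReal.ofReal (1 - (a + a - T) / T) * 2⁻¹ := by
          rw [← ofReal_half_mul]; congr 1; field_simp; ring
        have p1 : ENNReal.ofReal (a / T) = 2⁻¹ + ENNReal.ofReal ((a + a - T) / T) * 2⁻¹ := by
          rw [← ofReal_half_mul, ← h2, ← ENNReal.ofReal_add (by norm_num)]
          · congr 1; field_simp; ring
          · have : 0 ≤ (a + a - T) / T := div_nonneg (by linarith) h1.le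
            linarith
        simp only [pot]
        rw [p1, p2, add_right_comm (21 : ℝ≥0∞)]
        rw [show ∀ x : ℝ≥0∞, 1 + (1 + (1 + (1 + (1 + x)))) = 5 + x by intro x; ring]
        have h5 := five_steps_average_le e1 e2
        rw [add_right_comm (21 : ℝ≥0∞)] at h5
        refine (add_le_add le_rfl h5).trans (le_trans (le_of_eq ?_) half_step_le)
        rw [← add_assoc, show (5 : ℝ≥0∞) + 5 = 10 by norm_num]
    · cases b <;> simp [Test.Holds, IExp.eval, hs] at hb
  · rintro (a | b) s' ⟨hA, hs⟩ hb
    · simp [Test.Holds, IExp.eval, hs.1] at hb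
    · cases b
      · exact add_le_add le_rfl (hF₀ s' hA hs)
      · exact add_le_add le_rfl (hF₁ s' hA hs)

/-! ### Sampling by binary search -/

/-- With `l` and `r` in integer variables `3` and `4`, choose a position `e` between `l` and `r`
with probability proportional to the increment of real array `1` at `e`, and store it in integer
variable `3`. -/
def sample : Cmd :=
  .loop (.ilt (.add (.var 3) (.lit 1)) (.var 4))
    (.seq (.iset 5 (.half (.add (.var 3) (.var 4))))
    (.seq (.rset 0 (.sub (.get 1 (.var 5)) (.get 1 (.var 3))))
    (.seq (.rset 1 (.sub (.get 1 (.var 4)) (.get 1 (.var 3))))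
    (.seq (.iset 7 (.lit 2))
    (.seq bernoulli
      (.branch (.ieq (.var 7) (.lit 1)) (.iset 4 (.var 5)) (.iset 3 (.var 5))))))))

/-- Either half of an interval, even the one rounded up, has logarithmic depth smaller by one. -/
theorem clog_succ_le {a b : ℕ} (hb : 2 ≤ b) (hab : 2 * a ≤ b + 1) :
    Nat.clog 2 a + 1 ≤ Nat.clog 2 b := by
  rw [Nat.clog_of_two_le one_lt_two hb]
  exact Nat.succ_le_succ (Nat.clog_mono_right 2 (by omega))

/-- The chain rule for conditional probabilities: the chance of entering a half times the chance of
`e` within it is the chance of `e`. -/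
theorem sum_Ico_ofReal_mul_div {S : ℕ → ℝ} {l r : ℕ} {x y : ℝ} (hx : 0 < x) (hy : 0 ≤ y)
    (F : ℕ → ℝ≥0∞) :
    ENNReal.ofReal (x / y) * ∑ e ∈ Finset.Ico l r, ENNReal.ofReal ((S (e + 1) - S e) / x) * F e
      = ∑ e ∈ Finset.Ico l r, ENNReal.ofReal ((S (e + 1) - S e) / y) * F e := by
  rw [Finset.mul_sum]
  refine Finset.sum_congr rfl fun e _ => ?_
  rw [← mul_assoc, ← ENNReal.ofReal_mul (div_nonneg hx.le hy)]
  congr 2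
  field_simp

theorem ert_sample_le {f : State → ℝ≥0∞} {s : State} {F : ℕ → ℝ≥0∞} {l r : ℕ}
    (hl : s.ivar 3 = l) (hr : s.ivar 4 = r) (hlr : l < r)
    (hS : StrictMonoOn (s.rarr 1) (Set.Icc l r))
    (hF : ∀ s' e, Agree {3, 4, 5, 6, 7} s s' → e ∈ Set.Ico l r → s'.ivar 3 = e → f s' ≤ F e) :
    ert sample f s ≤ 34 * Nat.clog 2 (r - l) + 1 + ∑ e ∈ Finset.Ico l r,
      ENNReal.ofReal ((s.rarr 1 (e + 1) - s.rarr 1 e) / (s.rarr 1 r - s.rarr 1 l)) * F e := by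
  set S := s.rarr 1 with hSdef
  let Inv : ℕ × ℕ → State → Prop := fun g s' => Agree {3, 4, 5, 6, 7} s s' ∧
    s'.ivar 3 = g.1 ∧ s'.ivar 4 = g.2 ∧ l ≤ g.1 ∧ g.1 < g.2 ∧ g.2 ≤ r
  let pot : ℕ × ℕ → ℝ≥0∞ := fun g => 34 * Nat.clog 2 (g.2 - g.1) + 1 + ∑ e ∈ Finset.Ico g.1 g.2,
      ENNReal.ofReal ((S (e + 1) - S e) / (S g.2 - S g.1)) * F e
  refine ert_loop_le Inv pot ?_ ?_ (g := (l, r)) ⟨Agree.refl _ _, hl, hr, le_rfl, hlr, le_rfl⟩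
  · rintro ⟨a, b⟩ s' ⟨hA, h3, h4, hla, hab, hbr⟩ hb X hX
    simp only at h3 h4 hla hab hbr
    simp only [Test.Holds, IExp.eval, h3, h4] at hb
    obtain ⟨c, hc⟩ : ∃ c, c = (a + b) / 2 := ⟨_, rfl⟩
    have hac : a < c := by omega
    have hcb : c < b := by omega
    have hS1 : S a < S c := hS ⟨hla, by omega⟩ ⟨by omega, by omega⟩ hac
    have hS2 : S c < S b := hS ⟨by omega, by omega⟩ ⟨by omega, by omega⟩ hcb
    simp only [ert_seq, ert_rset, ert_iset, RExp.eval, IExp.eval,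
      ivar_setIVar, ivar_setRVar, rarr_setIVar, rarr_setRVar, h3, h4, hA.rarr, ← hSdef, ← hc]
    norm_num
    have key := ert_bernoulli_le (f := ert (.branch (.ieq (.var 7) (.lit 1)) (.iset 4 (.var 5))
      (.iset 3 (.var 5))) X) (s := ((((s'.setIVar 5 c).setRVar 0 (S c - S a)).setRVar 1
        (S b - S a)).setIVar 7 2)) (F₀ := 2 + pot (c, b)) (F₁ := 2 + pot (a, c))
        (by simp) (by simp [hS1.le]) (by simp [hS2.le]) (by simp; linarith) ?_ ?_
    rotate_left
    · intro s'' hA' h7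
      have e5 : s''.ivar 5 = c := by rw [hA'.ivar 5 (by simp)]; simp
      simp only [ert_branch, ert_iset, Test.Holds, IExp.eval, h7, e5]
      norm_num
      rw [← add_assoc, one_add_one_eq_two]
      refine add_le_add le_rfl (hX (c, b) _ ⟨?_, by simp, ?_, by simp; omega, by simpa, hbr⟩)
      · refine Agree.setIVar (Agree.trans ?_ (hA'.mono (by simp [Set.insert_subset_iff])))
          (by simp) _
        exact (((hA.setIVar (by simp) _).setRVar _ _).setRVar _ _).setIVar (by simp) _
      · simp [hA'.ivar 4, h4]
    · intro s'' hA' h7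
      have e5 : s''.ivar 5 = c := by rw [hA'.ivar 5 (by simp)]; simp
      simp only [ert_branch, ert_iset, Test.Holds, IExp.eval, h7, e5]
      norm_num
      rw [← add_assoc, one_add_one_eq_two]
      refine add_le_add le_rfl (hX (a, c) _ ⟨?_, ?_, by simp, hla, hac, by simp; omega⟩)
      · refine Agree.setIVar (Agree.trans ?_ (hA'.mono (by simp [Set.insert_subset_iff])))
          (by simp) _
        exact (((hA.setIVar (by simp) _).setRVar _ _).setRVar _ _).setIVar (by simp) _
      · simp [hA'.ivar 3, h3]
    simp only [rvar_setIVar, rvar_setRVar] at key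
    norm_num at key
    refine le_trans (add_le_add le_rfl (add_le_add le_rfl (add_le_add le_rfl (add_le_add le_rfl
      (add_le_add le_rfl (add_le_add le_rfl (add_le_add le_rfl (add_le_add le_rfl (add_le_add le_rfl
      (add_le_add le_rfl key)))))))))) ?_
    have hT : 0 < S b - S a := by linarith
    have hq : 1 - (S c - S a) / (S b - S a) = (S b - S c) / (S b - S a) := by field_simp; ring
    have hpq : ENNReal.ofReal ((S c - S a) / (S b - S a)) +
        ENNReal.ofReal ((S b - S c) / (S b - S a)) = 1 := by
      rw [← ENNReal.ofReal_add (div_nonneg (by linarith) hT.le) (div_nonneg (by linarith) hT.le),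
        ← ENNReal.ofReal_one]
      congr 1; field_simp; ring
    rw [hq]
    simp only [pot]
    rw [← Finset.sum_Ico_consecutive _ hac.le hcb.le,
      ← sum_Ico_ofReal_mul_div (x := S c - S a) (by linarith) hT.le F,
      ← sum_Ico_ofReal_mul_div (x := S b - S c) (by linarith) hT.le F]
    obtain ⟨k, hk⟩ : ∃ k, Nat.clog 2 (b - a) = k + 1 :=
      ⟨_, (Nat.succ_pred_eq_of_pos (Nat.clog_pos one_lt_two (by omega))).symm⟩
    have hk1 : Nat.clog 2 (c - a) ≤ k := by
      have := clog_succ_le (a := c - a) (b := b - a) (by omega) (by omega); omega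
    have hk2 : Nat.clog 2 (b - c) ≤ k := by
      have := clog_succ_le (a := b - c) (b := b - a) (by omega) (by omega); omega
    rw [hk]
    generalize ENNReal.ofReal ((S c - S a) / (S b - S a)) = p at *
    generalize ENNReal.ofReal ((S b - S c) / (S b - S a)) = q at *
    generalize ∑ e ∈ Finset.Ico a c, ENNReal.ofReal ((S (e + 1) - S e) / (S c - S a)) * F e = A
    generalize ∑ e ∈ Finset.Ico c b, ENNReal.ofReal ((S (e + 1) - S e) / (S b - S c)) * F e = B
    -- Here `34 = 10 + 21 + 2 + 1`: the steps around the toss, the toss, the branch on its outcome,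
    -- and the final loop test carried by the potential.
    calc _ ≤ 1 + (1 + (1 + (1 + (1 + (1 + (1 + (1 + (1 + (1 +
          (21 + p * (2 + (34 * (k : ℝ≥0∞) + 1 + A)) + q * (2 + (34 * (k : ℝ≥0∞) + 1 + B)))))))))))) := by
          gcongr
      _ = 31 + (p + q) * (3 + 34 * (k : ℝ≥0∞)) + (p * A + q * B) := by ring
      _ = 34 * ((k + 1 : ℕ) : ℝ≥0∞) + (p * A + q * B) := by rw [hpq]; push_cast; ring
      _ ≤ 34 * ((k + 1 : ℕ) : ℝ≥0∞) + 1 + (p * A + q * B) := by gcongr; exact le_self_add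
  · rintro ⟨a, b⟩ s' ⟨hA, h3, h4, hla, hab, hbr⟩ hb
    simp only at h3 h4 hla hab hbr
    simp only [Test.Holds, IExp.eval, h3, h4] at hb
    obtain rfl : b = a + 1 := by omega
    have : S a < S (a + 1) := hS ⟨hla, by omega⟩ ⟨by omega, by omega⟩ (by omega)
    have h1 : (S (a + 1) - S a) / (S (a + 1) - S a) = 1 := div_self (by linarith)
    simp [pot, h1]
    exact hF s' a hA ⟨hla, by omega⟩ h3

/-! ### Partial matchings and augmenting paths -/

/-- `mate v = u + 1` says that column `v` is matched to row `u`, and `mate v = 0` that it is not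
matched; `out` maps the matched rows to their columns. -/
def PartialMatching (n : ℕ) (E : ℕ → ℕ → Prop) (mate out : ℕ → ℕ) : Prop :=
  ∀ v < n, ∀ u, mate v = u + 1 → u < n ∧ E u v ∧ out u = v

/-- Row `u` is not matched. -/
def Unmatched (n : ℕ) (mate : ℕ → ℕ) (u : ℕ) : Prop := ∀ v < n, mate v ≠ u + 1

/-- The unmatched rows are those in `R`. -/
structure MatchingState (n : ℕ) (E : ℕ → ℕ → Prop) (mate out : ℕ → ℕ) (R : Set ℕ) : Prop where
  matching : PartialMatching n E mate out
  unmatched_iff : ∀ u < n, Unmatched n mate u ↔ u ∈ R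

/-- The row `u` takes a free column, which ends the augmentation with only `R` unmatched. -/
theorem MatchingState.augment_last {n : ℕ} {E : ℕ → ℕ → Prop} {mate out : ℕ → ℕ} {R : Set ℕ}
    {u v : ℕ} (h : MatchingState n E mate out (insert u R)) (hu : u < n) (huR : u ∉ R)
    (hv : v < n) (hE : E u v) (hmate : mate v = 0) :
    MatchingState n E (Function.update mate v (u + 1)) (Function.update out u v) R := by
  have hun : Unmatched n mate u := (h.unmatched_iff u hu).2 (Or.inl rfl)
  constructor
  · intro v' hv' u' he
    by_cases hvv : v' = v
    · subst hvv
      simp only [Function.update_self] at he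
      obtain rfl : u = u' := by omega
      exact ⟨hu, hE, by simp⟩
    · rw [Function.update_of_ne hvv] at he
      have huu : u' ≠ u := fun e => hun v' hv' (e ▸ he)
      rw [Function.update_of_ne huu]
      exact h.matching v' hv' u' he
  · intro u' hu'
    have h1 := h.unmatched_iff u' hu'
    constructor
    · intro hn
      have hne : u' ≠ u := by
        rintro rfl
        exact hn v hv (by simp)
      refine (h1.1 fun v' hv' he => ?_).resolve_left hne
      have hvv : v' ≠ v := by rintro rfl; omega
      exact hn v' hv' (by rw [Function.update_of_ne hvv, he])
    · intro hR v' hv' he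
      have hne : u' ≠ u := fun e => huR (e ▸ hR)
      by_cases hvv : v' = v
      · subst hvv
        simp only [Function.update_self] at he
        omega
      · rw [Function.update_of_ne hvv] at he
        exact h1.2 (Or.inr hR) v' hv' he

/-- The row `u` takes the column of `w`, so `w` becomes the extra unmatched row. The entry of `out`
at `w` goes stale, which is harmless: `PartialMatching` constrains `out` only at matched rows. -/
theorem MatchingState.augment_step {n : ℕ} {E : ℕ → ℕ → Prop} {mate out : ℕ → ℕ} {R : Set ℕ}
    {u v w : ℕ} (h : MatchingState n E mate out (insert u R)) (hu : u < n) (huR : u ∉ R)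
    (hv : v < n) (hE : E u v) (hmate : mate v = w + 1) :
    MatchingState n E (Function.update mate v (u + 1)) (Function.update out u v) (insert w R) ∧
      w < n ∧ w ∉ R := by
  have hun : Unmatched n mate u := (h.unmatched_iff u hu).2 (Or.inl rfl)
  obtain ⟨hw, -, hout⟩ := h.matching v hv w hmate
  have hwR : w ∉ insert u R := fun hR => (h.unmatched_iff w hw).2 hR v hv hmate
  have hwu : w ≠ u := fun e => hwR (Or.inl e)
  refine ⟨⟨?_, ?_⟩, hw, fun hR => hwR (Or.inr hR)⟩
  · intro v' hv' u' he
    by_cases hvv : v' = v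
    · subst hvv
      simp only [Function.update_self] at he
      obtain rfl : u = u' := by omega
      exact ⟨hu, hE, by simp⟩
    · rw [Function.update_of_ne hvv] at he
      have huu : u' ≠ u := fun e => hun v' hv' (e ▸ he)
      rw [Function.update_of_ne huu]
      exact h.matching v' hv' u' he
  · intro u' hu'
    have h1 := h.unmatched_iff u' hu'
    constructor
    · intro hn
      have hne : u' ≠ u := by
        rintro rfl
        exact hn v hv (by simp)
      by_cases hww : u' = w
      · exact Or.inl hww
      refine Or.inr ((h1.1 fun v' hv' he => ?_).resolve_left hne)
      have hvv : v' ≠ v := by rintro rfl; omega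
      exact hn v' hv' (by rw [Function.update_of_ne hvv, he])
    · intro hR v' hv' he
      have hne : u' ≠ u := by
        rintro rfl
        exact hR.elim (fun e => hwu e.symm) huR
      by_cases hvv : v' = v
      · subst hvv
        simp only [Function.update_self] at he
        omega
      · rw [Function.update_of_ne hvv] at he
        rcases hR with rfl | hR
        · exact hvv ((h.matching v' hv' u' he).2.2.symm.trans hout)
        · exact h1.2 (Or.inr hR) v' hv' he

/-- The rows of an alternating path, along `next` and `mate`, that ends in an unmatched column. -/
def IsAugPath (n : ℕ) (E : ℕ → ℕ → Prop) (mate next : ℕ → ℕ) : List ℕ → Prop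
  | [] => False
  | [u] => E u (next u) ∧ next u < n ∧ mate (next u) = 0
  | u :: w :: L => E u (next u) ∧ next u < n ∧ mate (next u) = w + 1 ∧
      IsAugPath n E mate next (w :: L)

theorem IsAugPath.mate_next {n : ℕ} {E : ℕ → ℕ → Prop} {mate next : ℕ → ℕ} :
    ∀ {w : ℕ} {L : List ℕ}, IsAugPath n E mate next (w :: L) →
      ∀ a ∈ w :: L, mate (next a) = 0 ∨ ∃ b ∈ L, mate (next a) = b + 1
  | w, [], h, a, ha => by
    obtain rfl := List.mem_singleton.1 ha
    exact Or.inl h.2.2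
  | w, w' :: L, h, a, ha => by
    rcases List.mem_cons.1 ha with rfl | ha
    · exact Or.inr ⟨w', by simp, h.2.2.1⟩
    · rcases h.2.2.2.mate_next a ha with h0 | ⟨b, hb, h1⟩
      · exact Or.inl h0
      · exact Or.inr ⟨b, by simp [hb], h1⟩

theorem IsAugPath.congr_mate {n : ℕ} {E : ℕ → ℕ → Prop} {mate mate' next : ℕ → ℕ} :
    ∀ {L : List ℕ}, IsAugPath n E mate next L → (∀ a ∈ L, mate' (next a) = mate (next a)) →
      IsAugPath n E mate' next L
  | [u], h, hm => ⟨h.1, h.2.1, (hm u (by simp)).trans h.2.2⟩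
  | u :: w :: L, h, hm => ⟨h.1, h.2.1, (hm u (by simp)).trans h.2.2.1,
      h.2.2.2.congr_mate fun a ha => hm a (List.mem_cons_of_mem _ ha)⟩

/-- Rewriting the mate of `next u` does not disturb the rest: a later row leaving through the same
column would lead to `w` again, against the absence of repetitions. -/
theorem IsAugPath.tail {n : ℕ} {E : ℕ → ℕ → Prop} {mate next : ℕ → ℕ} {u w x : ℕ} {L : List ℕ}
    (h : IsAugPath n E mate next (u :: w :: L)) (hnd : (u :: w :: L).Nodup) :
    IsAugPath n E (Function.update mate (next u) x) next (w :: L) := by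
  refine h.2.2.2.congr_mate fun a ha => Function.update_of_ne (fun e => ?_) _ _
  have h1 := h.2.2.2.mate_next a ha
  rw [e, h.2.2.1] at h1
  rcases h1 with h1 | ⟨b, hb, h1⟩
  · omega
  · obtain rfl : w = b := by omega
    simp only [List.nodup_cons] at hnd
    exact hnd.2.1 hb

/-- A loop-erased walk from its last element to its first one: every row is left along `next`. -/
def IsWalkPath (n : ℕ) (E : ℕ → ℕ → Prop) (mate next : ℕ → ℕ) (L : List ℕ) : Prop :=
  L.Nodup ∧ L.IsChain fun b a => E a (next a) ∧ next a < n ∧ mate (next a) = b + 1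

theorem IsWalkPath.isAugPath_reverse_append {n : ℕ} {E : ℕ → ℕ → Prop} {mate next : ℕ → ℕ} :
    ∀ (L : List ℕ) (x : ℕ) (F : List ℕ),
      (x :: L).IsChain (fun b a => E a (next a) ∧ next a < n ∧ mate (next a) = b + 1) →
      IsAugPath n E mate next (x :: F) → IsAugPath n E mate next (L.reverse ++ x :: F)
  | [], x, F, _, hF => hF
  | a :: L, x, F, hL, hF => by
    rw [List.isChain_cons_cons] at hL
    rw [List.reverse_cons, List.append_assoc]
    exact isAugPath_reverse_append L a (x :: F) hL.2 ⟨hL.1.1, hL.1.2.1, hL.1.2.2, hF⟩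

/-- The chain uses `next` only at rows after the head, so the head may be redirected freely. -/
theorem IsWalkPath.isChain_update {n : ℕ} {E : ℕ → ℕ → Prop} {mate next : ℕ → ℕ} {x : ℕ}
    {L : List ℕ} (h : IsWalkPath n E mate next (x :: L)) (v : ℕ) :
    (x :: L).IsChain fun b a => E a (Function.update next x v a) ∧
      Function.update next x v a < n ∧ mate (Function.update next x v a) = b + 1 := by
  refine List.IsChain.imp_of_mem_tail_imp (fun b a _ ha hab => ?_) h.2
  have hax : a ≠ x := by
    rintro rfl
    exact (List.nodup_cons.1 h.1).1 ha
  rwa [Function.update_of_ne hax]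

theorem IsWalkPath.isAugPath {n : ℕ} {E : ℕ → ℕ → Prop} {mate next : ℕ → ℕ} {x v : ℕ} {L : List ℕ}
    (h : IsWalkPath n E mate next (x :: L)) (hE : E x v) (hv : v < n) (hmate : mate v = 0) :
    IsAugPath n E mate (Function.update next x v) (x :: L).reverse := by
  rw [List.reverse_cons]
  exact isAugPath_reverse_append L x [] (h.isChain_update v) (by simp [IsAugPath, hE, hv, hmate])

/-- The machine erases loops for free by overwriting `next`. If `w` was on the path, the path is cut
back to `w`; otherwise it grows by one row. -/
theorem IsWalkPath.step {n : ℕ} {E : ℕ → ℕ → Prop} {mate next : ℕ → ℕ} {x v w : ℕ} {L : List ℕ}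
    (h : IsWalkPath n E mate next (x :: L)) (hE : E x v) (hv : v < n) (hmate : mate v = w + 1) :
    ∃ L', IsWalkPath n E mate (Function.update next x v) (w :: L') ∧
      L'.length ≤ L.length + 1 ∧ (w :: L').getLast? = (x :: L).getLast? := by
  have hc := h.isChain_update v
  by_cases hw : w ∈ x :: L
  · obtain ⟨A, B, hAB⟩ := List.append_of_mem hw
    have hs : w :: B <:+ x :: L := ⟨A, hAB.symm⟩
    refine ⟨B, ⟨h.1.sublist hs.sublist, hc.suffix hs⟩, ?_, ?_⟩
    · have := hs.length_le
      simp only [List.length_cons] at this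
      omega
    · rw [hAB, List.getLast?_append_cons]
  · refine ⟨x :: L, ⟨List.nodup_cons.2 ⟨hw, h.1⟩, ?_⟩, by simp, by simp⟩
    rw [List.isChain_cons_cons]
    exact ⟨by simp [hE, hv, hmate], hc⟩

/-! ### The expected length of a random walk along a partial matching -/

section Walk

variable (n : ℕ) (W : ℕ → ℕ → ℝ≥0∞) (mate : ℕ → ℕ)

/-- The expected number of moves, truncated after `t` moves, of the walk that moves from row `u` to
a column with distribution `W u`, ends there if the column is not matched, and goes on to the row
matched to the column otherwise. -/
noncomputable def truncWalkTime : ℕ → ℕ → ℝ≥0∞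
  | 0, _ => 0
  | t + 1, u => 1 + ∑ v ∈ Finset.range n,
      W u v * if mate v = 0 then 0 else truncWalkTime t (mate v - 1)

/-- The expected number of moves of the walk from row `u`. -/
noncomputable def walkTime (u : ℕ) : ℝ≥0∞ := ⨆ t, truncWalkTime n W mate t u

theorem truncWalkTime_mono_succ (t u : ℕ) :
    truncWalkTime n W mate t u ≤ truncWalkTime n W mate (t + 1) u := by
  induction t generalizing u with
  | zero => simp [truncWalkTime]
  | succ t ih =>
    rw [truncWalkTime, truncWalkTime]
    gcongr with v hv
    split_ifs
    exacts [le_rfl, ih _]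

theorem monotone_truncWalkTime (u : ℕ) : Monotone fun t => truncWalkTime n W mate t u :=
  monotone_nat_of_le_succ fun t => truncWalkTime_mono_succ n W mate t u

/-- Monotone convergence in the recursion for truncated walks. Only this direction is needed, since
`walkTime` serves as a potential. -/
theorem walkTime_ge (u : ℕ) :
    1 + ∑ v ∈ Finset.range n, W u v * (if mate v = 0 then 0 else walkTime n W mate (mate v - 1))
      ≤ walkTime n W mate u := by
  have h : ∀ v, W u v * (if mate v = 0 then 0 else walkTime n W mate (mate v - 1)) =
      ⨆ t, W u v * if mate v = 0 then 0 else truncWalkTime n W mate t (mate v - 1) := by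
    intro v
    split_ifs
    · simp
    · rw [walkTime, ENNReal.mul_iSup]
  simp only [h]
  rw [ENNReal.finsetSum_iSup_of_monotone, ENNReal.add_iSup]
  · exact iSup_le fun t => le_iSup_of_le (t + 1) le_rfl
  · intro v t t' ht
    dsimp only
    gcongr
    split_ifs
    exacts [le_rfl, monotone_truncWalkTime n W mate _ ht]

theorem truncWalkTime_ne_top (hW : ∀ u v, W u v ≠ ⊤) (t u : ℕ) :
    truncWalkTime n W mate t u ≠ ⊤ := by
  induction t generalizing u with
  | zero => simp [truncWalkTime]
  | succ t ih =>
    rw [truncWalkTime]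
    refine ENNReal.add_ne_top.2 ⟨by simp, ENNReal.sum_ne_top.2 fun v _ => ?_⟩
    refine ENNReal.mul_ne_top (hW u v) ?_
    split_ifs
    exacts [by simp, ih _]

variable {n W mate} in
/-- The walks from the unmatched rows have total expected length at most `n`. -/
theorem sum_walkTime_le (hW : ∀ u v, W u v ≠ ⊤)
    (hcol : ∀ v < n, ∑ u ∈ Finset.range n, W u v ≤ 1) {E : ℕ → ℕ → Prop} {out : ℕ → ℕ}
    (hm : PartialMatching n E mate out) (U : Finset ℕ)
    (hU : ∀ u ∈ U, u < n ∧ Unmatched n mate u) : ∑ u ∈ U, walkTime n W mate u ≤ n := by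
  classical
  simp only [walkTime]
  rw [ENNReal.finsetSum_iSup_of_monotone fun u => monotone_truncWalkTime n W mate u]
  refine iSup_le fun t => ?_
  refine (Finset.sum_le_sum fun u _ => truncWalkTime_mono_succ n W mate t u).trans ?_
  have hUn : U ⊆ Finset.range n := fun u hu => Finset.mem_range.2 (hU u hu).1
  set V := Finset.range n \ U with hV
  -- Truncated times are finite, so the sum over the matched rows may be cancelled. This is why the
  -- argument is run on truncations.
  have hfin : ∑ u ∈ V, truncWalkTime n W mate (t + 1) u ≠ ⊤ :=
    ENNReal.sum_ne_top.2 fun u _ => truncWalkTime_ne_top n W mate hW _ u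
  refine (ENNReal.add_le_add_iff_left hfin).1 ?_
  rw [Finset.sum_sdiff hUn]
  set g : ℕ → ℝ≥0∞ := fun v => if mate v = 0 then 0 else truncWalkTime n W mate t (mate v - 1)
    with hg
  -- Exchanging the sums brings in the column sums, which are at most one.
  have h1 : ∑ u ∈ Finset.range n, truncWalkTime n W mate (t + 1) u
      ≤ n + ∑ v ∈ Finset.range n, g v := by
    simp only [truncWalkTime, Finset.sum_add_distrib, Finset.sum_const, Finset.card_range,
      nsmul_eq_mul, mul_one]
    rw [Finset.sum_comm]
    gcongr with v hv
    rw [← Finset.sum_mul]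
    exact mul_le_of_le_one_left' (hcol v (Finset.mem_range.1 hv))
  -- Distinct matched columns have distinct mates, and these mates lie outside `U`.
  have h2 : ∑ v ∈ Finset.range n, g v ≤ ∑ u ∈ V, truncWalkTime n W mate (t + 1) u := by
    rw [← Finset.sum_filter_add_sum_filter_not (Finset.range n) (fun v => mate v = 0)]
    rw [Finset.sum_eq_zero (s := Finset.filter (fun v => mate v = 0) _)
      (fun v hv => by simp [hg, (Finset.mem_filter.1 hv).2]), zero_add]
    have h3 : ∑ v ∈ Finset.filter (fun v => ¬ mate v = 0) (Finset.range n), g v =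
        ∑ u ∈ (Finset.filter (fun v => ¬ mate v = 0) (Finset.range n)).image (fun v => mate v - 1),
          truncWalkTime n W mate t u := by
      rw [Finset.sum_image]
      · exact Finset.sum_congr rfl fun v hv => by simp [hg, (Finset.mem_filter.1 hv).2]
      · intro v hv v' hv' he
        simp only [Finset.coe_filter, Finset.mem_range, Set.mem_ofPred_eq] at hv hv' he
        have e1 := (hm v hv.1 (mate v - 1) (by omega)).2.2
        have e2 := (hm v' hv'.1 (mate v - 1) (by omega)).2.2
        exact e1.symm.trans e2
    rw [h3]
    refine (Finset.sum_le_sum fun u _ => truncWalkTime_mono_succ n W mate t u).trans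
      (Finset.sum_le_sum_of_subset ?_)
    intro u hu
    obtain ⟨v, hv, rfl⟩ := Finset.mem_image.1 hu
    obtain ⟨hv, hv0⟩ := Finset.mem_filter.1 hv
    have hv := Finset.mem_range.1 hv
    rw [hV, Finset.mem_sdiff, Finset.mem_range]
    exact ⟨(hm v hv _ (by omega)).1, fun hu => (hU _ hu).2 v hv (by omega)⟩
  exact (h1.trans (add_le_add le_rfl h2)).trans_eq (add_comm _ _)

end Walk

/-! ### Walking and augmenting on the machine -/

/-- The data of a doubly stochastic matrix that the matching phase uses: `W` are the entries, `E`
the edges, `ptr` and `col` the adjacency arrays, and `S` the prefix sums of the entries in the order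
of the adjacency arrays, continued by increments of one. -/
structure WalkData where
  n : ℕ
  ptr : ℕ → ℕ
  col : ℕ → ℕ
  S : ℕ → ℝ
  W : ℕ → ℕ → ℝ≥0∞
  E : ℕ → ℕ → Prop
  ptr_lt : ∀ u < n, ptr u < ptr (u + 1)
  ptr_le : ∀ u < n, ptr (u + 1) ≤ ptr n
  deg_le : ∀ u < n, ptr (u + 1) - ptr u ≤ n
  strictMonoOn : StrictMonoOn S (Set.Icc 0 (ptr n + n))
  row_total : ∀ u < n, S (ptr (u + 1)) - S (ptr u) = 1
  tail : ∀ i ≤ n, S (ptr n + i) = S (ptr n) + i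
  edge : ∀ u < n, ∀ e ∈ Set.Ico (ptr u) (ptr (u + 1)), col e < n ∧ E u (col e)
  sum_row : ∀ u < n, ∀ F : ℕ → ℝ≥0∞, ∑ e ∈ Finset.Ico (ptr u) (ptr (u + 1)),
    ENNReal.ofReal (S (e + 1) - S e) * F (col e) = ∑ v ∈ Finset.range n, W u v * F v
  W_ne_top : ∀ u v, W u v ≠ ⊤
  W_row : ∀ u < n, ∑ v ∈ Finset.range n, W u v = 1
  W_col : ∀ v < n, ∑ u ∈ Finset.range n, W u v ≤ 1

/-- The memory holds the data `D`, and the `k` cells after the adjacency arrays list the elements of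
`R`. -/
structure WalkData.Mem (D : WalkData) (k : ℕ) (R : Finset ℕ) (s : State) : Prop where
  ivar0 : s.ivar 0 = D.n
  ivar1 : s.ivar 1 = D.ptr D.n
  ivar2 : s.ivar 2 = k
  iarr0 : s.iarr 0 = D.ptr
  iarr1 : ∀ e < D.ptr D.n, s.iarr 1 e = D.col e
  rarr1 : s.rarr 1 = D.S
  injOn : Set.InjOn (fun i => s.iarr 1 (D.ptr D.n + i)) (Set.Iio k)
  mem_iff : ∀ u, u ∈ R ↔ ∃ i < k, s.iarr 1 (D.ptr D.n + i) = u

theorem WalkData.Mem.congr {D : WalkData} {k : ℕ} {R : Finset ℕ} {s s' : State} (h : D.Mem k R s)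
    (h0 : s'.ivar 0 = s.ivar 0) (h1 : s'.ivar 1 = s.ivar 1) (h2 : s'.ivar 2 = s.ivar 2)
    (i0 : s'.iarr 0 = s.iarr 0) (i1 : s'.iarr 1 = s.iarr 1) (r1 : s'.rarr 1 = s.rarr 1) :
    D.Mem k R s' where
  ivar0 := h0.trans h.ivar0
  ivar1 := h1.trans h.ivar1
  ivar2 := h2.trans h.ivar2
  iarr0 := i0.trans h.iarr0
  iarr1 := i1 ▸ h.iarr1
  rarr1 := r1.trans h.rarr1
  injOn := i1 ▸ h.injOn
  mem_iff := i1 ▸ h.mem_iff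

/-- Augment along the path that starts in the row in variable `8`, until variable `11` is zero. -/
def augment : Cmd :=
  .loop (.not (.ieq (.var 11) (.lit 0)))
    (.seq (.iset 10 (.get 4 (.var 8)))
    (.seq (.iset 11 (.get 3 (.var 10)))
    (.seq (.iput 3 (.var 10) (.add (.var 8) (.lit 1)))
    (.seq (.iput 2 (.var 8) (.var 10))
      (.iset 8 (.sub (.var 11) (.lit 1)))))))

/-- The list of rows still to be processed is the auxiliary value of the loop; each row costs ten
steps. -/
theorem ert_augment_le {D : WalkData} {k : ℕ} {R : Finset ℕ} {X : State → ℝ≥0∞} {B : ℝ≥0∞}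
    (hX : ∀ s', D.Mem k R s' → MatchingState D.n D.E (s'.iarr 3) (s'.iarr 2) R → X s' ≤ B)
    {s : State} {u : ℕ} {L : List ℕ} (hM : D.Mem k R s)
    (hm : MatchingState D.n D.E (s.iarr 3) (s.iarr 2) (insert u (R : Set ℕ)))
    (hu : u < D.n) (huR : u ∉ R) (h8 : s.ivar 8 = u) (h11 : s.ivar 11 ≠ 0)
    (hL : (u :: L).Nodup) (hp : IsAugPath D.n D.E (s.iarr 3) (s.iarr 4) (u :: L)) :
    ert augment X s ≤ 10 * (u :: L).length + 1 + B := by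
  let Inv : List ℕ → State → Prop := fun L s => D.Mem k R s ∧ match L with
    | [] => s.ivar 11 = 0 ∧ MatchingState D.n D.E (s.iarr 3) (s.iarr 2) R
    | u :: L => s.ivar 11 ≠ 0 ∧
      MatchingState D.n D.E (s.iarr 3) (s.iarr 2) (insert u (R : Set ℕ)) ∧
      u < D.n ∧ u ∉ R ∧ s.ivar 8 = u ∧ (u :: L).Nodup ∧
      IsAugPath D.n D.E (s.iarr 3) (s.iarr 4) (u :: L)
  refine ert_loop_le Inv (fun L => 10 * L.length + 1 + B) ?_ ?_ (g := u :: L)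
    ⟨hM, h11, hm, hu, huR, h8, hL, hp⟩
  · rintro (_ | ⟨u, L⟩) s ⟨hM, hs⟩ hb X hX
    · simp [Test.Holds, IExp.eval, hs.1] at hb
    obtain ⟨h11, hm, hu, huR, h8, hnd, hp⟩ := hs
    have hedge : D.E u (s.iarr 4 u) ∧ s.iarr 4 u < D.n := by
      cases L with
      | nil => exact ⟨hp.1, hp.2.1⟩
      | cons w L => exact ⟨hp.1, hp.2.1⟩
    obtain ⟨v, hv⟩ : ∃ v, v = s.iarr 4 u := ⟨_, rfl⟩
    rw [← hv] at hedge
    simp only [ert_seq, ert_iset, ert_iput, IExp.eval, ivar_setIVar, iarr_setIVar, ivar_setIArr, h8]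
    norm_num
    simp only [← hv]
    rw [show ∀ x : ℝ≥0∞, 1 + (1 + (1 + (1 + (1 + (1 + (1 + (1 + (1 + (1 + x))))))))) = 10 + x by
      intro x; ring]
    rw [show 10 * ((L.length : ℝ≥0∞) + 1) + 1 + B = 10 + (10 * L.length + 1 + B) by ring]
    refine add_le_add le_rfl (hX L _ ⟨hM.congr (by simp) (by simp) (by simp) (by simp) (by simp)
      (by simp), ?_⟩)
    cases L with
    | nil =>
      refine ⟨by simp [hv, hp.2.2], ?_⟩
      simp
      exact hm.augment_last hu huR hedge.2 hedge.1 (hv ▸ hp.2.2)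
    | cons w L =>
      have hw : s.iarr 3 v = w + 1 := hv ▸ hp.2.2.1
      obtain ⟨hm', hwn, hwR⟩ := hm.augment_step hu huR hedge.2 hedge.1 hw
      refine ⟨by simp [hw], by simpa using hm', hwn, hwR, by simp [hw], (List.nodup_cons.1 hnd).2, ?_⟩
      have := hp.tail hnd (x := u + 1)
      rw [← hv] at this
      simpa using this
  · rintro (_ | ⟨u, L⟩) s ⟨hM, hs⟩ hb
    · simpa using add_le_add (le_refl (1 : ℝ≥0∞)) (hX s hM hs.2)
    · simp [Test.Holds, IExp.eval, hs.1] at hb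

/-- Walk from the row in variable `8` until an unmatched column is reached. -/
def walk : Cmd :=
  .loop (.not (.ieq (.var 11) (.lit 0)))
    (.seq (.iset 3 (.get 0 (.var 8)))
    (.seq (.iset 4 (.get 0 (.add (.var 8) (.lit 1))))
    (.seq sample
    (.seq (.iset 10 (.get 1 (.var 3)))
    (.seq (.iput 4 (.var 8) (.var 10))
    (.seq (.iset 11 (.get 3 (.var 10)))
      (.iset 8 (.sub (.var 11) (.lit 1)))))))))

/-- A bound for the expected cost of one move of the walk. -/
noncomputable def WalkData.cost (D : WalkData) : ℝ≥0∞ := 34 * Nat.clog 2 D.n + 24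

/-- The potential is the expected number of remaining moves times `D.cost`, plus ten steps saved for
each row on the current loop-erased path. These savings pay for the augmentation `X`. -/
theorem ert_walk_le {D : WalkData} {k : ℕ} {R : Finset ℕ} {X : State → ℝ≥0∞} {B : ℝ≥0∞}
    {mate out : ℕ → ℕ} {u₀ : ℕ} {Q : Set ℕ} (hm : MatchingState D.n D.E mate out Q)
    (hX : ∀ s' L, D.Mem k R s' → s'.iarr 3 = mate → s'.iarr 2 = out → s'.ivar 9 = u₀ →
      (u₀ :: L).Nodup → IsAugPath D.n D.E mate (s'.iarr 4) (u₀ :: L) →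
      X s' ≤ 10 * (u₀ :: L).length + B)
    {s : State} (hM : D.Mem k R s) (h3 : s.iarr 3 = mate) (h2 : s.iarr 2 = out)
    (hu : u₀ < D.n) (h8 : s.ivar 8 = u₀) (h9 : s.ivar 9 = u₀) (h11 : s.ivar 11 ≠ 0) :
    ert walk X s ≤ D.cost * walkTime D.n D.W mate u₀ + (11 + B) := by
  let Inv : List ℕ ⊕ List ℕ → State → Prop := fun g s =>
    D.Mem k R s ∧ s.iarr 3 = mate ∧ s.iarr 2 = out ∧ s.ivar 9 = u₀ ∧ match g with
    | .inl L => s.ivar 11 ≠ 0 ∧ s.ivar 8 < D.n ∧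
      IsWalkPath D.n D.E mate (s.iarr 4) L ∧ L.getLast? = some u₀ ∧ L.head? = some (s.ivar 8)
    | .inr L => s.ivar 11 = 0 ∧ (u₀ :: L).Nodup ∧ IsAugPath D.n D.E mate (s.iarr 4) (u₀ :: L)
  let pot : List ℕ ⊕ List ℕ → ℝ≥0∞ := fun g => match g with
    | .inl L => D.cost * walkTime D.n D.W mate L.headI + (10 * L.length + 1 + B)
    | .inr L => 10 * (u₀ :: L).length + 1 + B
  have key : ert walk X s ≤ pot (.inl [u₀]) := by
    refine ert_loop_le Inv pot ?_ ?_ (g := .inl [u₀]) ⟨hM, h3, h2, h9, h11, by simpa [h8],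
      ⟨by simp, by simp⟩, by simp, by simp [h8]⟩
    · rintro (L | L) s ⟨hM, h3, h2, h9, hs⟩ hb X hX
      swap
      · simp [Test.Holds, IExp.eval, hs.1] at hb
      obtain ⟨h11, hu, hL, hlast, hhead⟩ := hs
      obtain ⟨u, h8⟩ : ∃ u, u = s.ivar 8 := ⟨_, rfl⟩
      rw [← h8] at hu hhead
      obtain ⟨L, rfl⟩ := List.head?_eq_some_iff.1 hhead
      have hlt := D.ptr_lt u hu
      have hle := D.ptr_le u hu
      simp only [ert_seq, ert_iset, IExp.eval, ivar_setIVar, iarr_setIVar, hM.iarr0, ← h8]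
      norm_num
      set Z : ℝ≥0∞ := 10 * (u :: L).length + 11 + B with hZ
      have hsample := ert_sample_le
        (f := ert (.seq (.iset 10 (.get 1 (.var 3)))
          (.seq (.iput 4 (.var 8) (.var 10))
          (.seq (.iset 11 (.get 3 (.var 10)))
            (.iset 8 (.sub (.var 11) (.lit 1)))))) X)
        (s := (s.setIVar 3 (D.ptr u)).setIVar 4 (D.ptr (u + 1)))
        (F := fun e => 7 + (D.cost * (if mate (D.col e) = 0 then 0 else
          walkTime D.n D.W mate (mate (D.col e) - 1)) + Z))
        (l := D.ptr u) (r := D.ptr (u + 1)) (by simp) (by simp) hlt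
        (by
          simp only [rarr_setIVar, hM.rarr1]
          exact D.strictMonoOn.mono (Set.Icc_subset_Icc (Nat.zero_le _) (by omega))) ?_
      · simp only [rarr_setIVar, hM.rarr1, D.row_total u hu, div_one] at hsample
        rw [D.sum_row u hu fun v => 7 + (D.cost * (if mate v = 0 then 0 else
          walkTime D.n D.W mate (mate v - 1)) + Z)] at hsample
        simp only [mul_add, Finset.sum_add_distrib, ← Finset.sum_mul, D.W_row u hu, one_mul,
          mul_left_comm _ D.cost] at hsample
        rw [← Finset.mul_sum] at hsample
        set g := ∑ v ∈ Finset.range D.n, D.W u v *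
          if mate v = 0 then 0 else walkTime D.n D.W mate (mate v - 1)
        have hclog : Nat.clog 2 (D.ptr (u + 1) - D.ptr u) ≤ Nat.clog 2 D.n :=
          Nat.clog_mono_right 2 (D.deg_le u hu)
        rw [show ∀ x : ℝ≥0∞, 1 + (1 + (1 + (1 + (1 + (1 + x))))) = 6 + x by intro x; ring]
        calc _ ≤ 6 + (34 * (Nat.clog 2 D.n : ℝ≥0∞) + 1 + (7 + (D.cost * g + Z))) := by
              refine add_le_add le_rfl (hsample.trans ?_)
              have hc : (Nat.clog 2 (D.ptr (u + 1) - D.ptr u) : ℝ≥0∞) ≤ Nat.clog 2 D.n := by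
                exact_mod_cast hclog
              exact add_le_add (add_le_add (mul_le_mul_right hc _) le_rfl) le_rfl
          -- The constant `24` in `D.cost` is `6 + 1 + 7 + 10`: the steps before sampling, the last
          -- test of `sample`, the steps after it, and the saving for a new path row.
          _ = D.cost * (1 + g) + (10 * (u :: L).length + 1 + B) := by
              rw [hZ, WalkData.cost]; ring
          _ ≤ _ := add_le_add (mul_le_mul_right (walkTime_ge D.n D.W mate u) _) le_rfl
      · intro s' e hA he h3'
        obtain ⟨hv, hE⟩ := D.edge u hu e he
        have heq : e < D.ptr D.n := lt_of_lt_of_le he.2 hle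
        have i1 : s'.iarr 1 e = D.col e := by rw [hA.iarr]; simpa using hM.iarr1 e heq
        have i3 : s'.iarr 3 = mate := by rw [hA.iarr]; simpa using h3
        have i2 : s'.iarr 2 = out := by rw [hA.iarr]; simpa using h2
        have i4 : s'.iarr 4 = s.iarr 4 := by rw [hA.iarr]; simp
        have v8 : s'.ivar 8 = u := by rw [hA.ivar 8 (by simp)]; simp [h8]
        have v9 : s'.ivar 9 = u₀ := by rw [hA.ivar 9 (by simp)]; simp [h9]
        have hM' : D.Mem k R s' := hM.congr (by rw [hA.ivar 0 (by simp)]; simp)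
          (by rw [hA.ivar 1 (by simp)]; simp) (by rw [hA.ivar 2 (by simp)]; simp)
          (by rw [hA.iarr]; simp) (by rw [hA.iarr]; simp) (by rw [hA.rarr]; simp)
        obtain ⟨v, hvdef⟩ : ∃ v, v = D.col e := ⟨_, rfl⟩
        rw [← hvdef] at hv hE i1 ⊢
        simp only [ert_seq, ert_iset, ert_iput, IExp.eval, ivar_setIVar, ivar_setIArr, h3']
        norm_num
        rw [i1, v8, i3]
        rw [show ∀ x : ℝ≥0∞, 1 + (1 + (1 + (1 + (1 + (1 + (1 + x)))))) = 7 + x by intro x; ring]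
        refine add_le_add le_rfl ?_
        rcases hmv : mate v with _ | w
        · obtain ⟨F, hF⟩ : ∃ F, (u :: L).reverse = u₀ :: F := by
            rw [← List.head?_eq_some_iff, List.head?_reverse, hlast]
          have hlen : (u₀ :: F).length = (u :: L).length := by rw [← hF, List.length_reverse]
          refine (hX (.inr F) _ ⟨hM'.congr (by simp) (by simp) (by simp) (by simp) (by simp)
            (by simp), by simp [i3], by simp [i2], by simp [v9], by simp, ?_, ?_⟩).trans ?_
          · rw [← hF]; exact List.nodup_reverse.2 hL.1
          · rw [← hF]
            simpa [i4] using hL.isAugPath hE hv hmv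
          · simp only [pot, hlen, if_true, zero_add, hZ]
            gcongr
            norm_num
        · obtain ⟨L', hL', hlen, hlast'⟩ := hL.step hE hv hmv
          refine (hX (.inl (w :: L')) _ ⟨hM'.congr (by simp) (by simp) (by simp) (by simp) (by simp)
            (by simp), by simp [i3], by simp [i2], by simp [v9], by simp, ?_, ?_, ?_, ?_⟩).trans ?_
          · simpa using (hm.matching v hv w hmv).1
          · simpa [i4] using hL'
          · rw [hlast', hlast]
          · simp
          · simp only [pot, List.headI, hZ]
            simp only [Nat.add_eq_zero_iff, one_ne_zero, and_false, if_false, Nat.add_sub_cancel]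
            refine add_le_add le_rfl ?_
            have : ((w :: L').length : ℝ≥0∞) ≤ (u :: L).length + 1 := by
              exact_mod_cast (by simpa using hlen : (w :: L').length ≤ (u :: L).length + 1)
            calc 10 * ((w :: L').length : ℝ≥0∞) + 1 + B
                ≤ 10 * ((u :: L).length + 1) + 1 + B := by gcongr
              _ = _ := by ring
    · rintro (L | L) s ⟨hM, h3, h2, h9, hs⟩ hb
      · simp [Test.Holds, IExp.eval, hs.1] at hb
      · have := hX s L hM h3 h2 h9 hs.2.1 hs.2.2
        simp only [pot]
        calc _ ≤ _ := add_le_add le_rfl this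
          _ = _ := by ring
  refine key.trans (le_of_eq ?_)
  simp only [pot, List.headI, List.length_singleton, Nat.cast_one]
  ring

/-- Choose an unmatched row at random, and augment along a random walk from it. -/
def phase : Cmd :=
  .seq (.iset 3 (.var 1))
    (.seq (.iset 4 (.add (.var 1) (.var 2)))
    (.seq sample
    (.seq (.iset 9 (.get 1 (.var 3)))
    (.seq (.iset 2 (.sub (.var 2) (.lit 1)))
    (.seq (.iput 1 (.var 3) (.get 1 (.add (.var 1) (.var 2))))
    (.seq (.iset 8 (.var 9))
    (.seq (.iset 11 (.lit 1))
    (.seq walk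
    (.seq (.iset 8 (.var 9))
    (.seq (.iset 11 (.lit 1))
      augment))))))))))

/-- The vacated cell `i` receives the last element of the list, so the list stays contiguous; for `i
= k` it just gets shorter. -/
theorem WalkData.Mem.remove {D : WalkData} {k : ℕ} {R : Finset ℕ} {s s' : State}
    (h : D.Mem (k + 1) R s) {i : ℕ} (hi : i ≤ k)
    (h0 : s'.ivar 0 = s.ivar 0) (h1 : s'.ivar 1 = s.ivar 1) (h2 : s'.ivar 2 = k)
    (i0 : s'.iarr 0 = s.iarr 0)
    (i1 : s'.iarr 1 = Function.update (s.iarr 1) (D.ptr D.n + i) (s.iarr 1 (D.ptr D.n + k)))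
    (r1 : s'.rarr 1 = s.rarr 1) :
    D.Mem k (R.erase (s.iarr 1 (D.ptr D.n + i))) s' := by
  have hval : ∀ j, s'.iarr 1 (D.ptr D.n + j) =
      if j = i then s.iarr 1 (D.ptr D.n + k) else s.iarr 1 (D.ptr D.n + j) := by
    intro j
    rw [i1, Function.update_apply]
    simp
  have hinj : ∀ a ≤ k, ∀ b ≤ k, s.iarr 1 (D.ptr D.n + a) = s.iarr 1 (D.ptr D.n + b) → a = b :=
    fun a ha b hb he => h.injOn (Nat.lt_succ_of_le ha) (Nat.lt_succ_of_le hb) he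
  refine ⟨h0.trans h.ivar0, h1.trans h.ivar1, h2, i0.trans h.iarr0, ?_, r1.trans h.rarr1, ?_, ?_⟩
  · intro e he
    rw [i1, Function.update_of_ne (by omega), h.iarr1 e he]
  · intro a ha b hb he
    simp only [Set.mem_Iio, hval] at ha hb he
    split_ifs at he with h1 h2 h2
    · omega
    · have := hinj _ le_rfl _ hb.le he; omega
    · have := hinj _ ha.le _ le_rfl he; omega
    · exact hinj _ ha.le _ hb.le he
  · intro u
    rw [Finset.mem_erase, h.mem_iff]
    constructor
    · rintro ⟨hne, j, hj, rfl⟩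
      have hji : j ≠ i := by rintro rfl; exact hne rfl
      by_cases hjk : j = k
      · subst hjk
        exact ⟨i, by omega, by simp [hval]⟩
      · exact ⟨j, by omega, by simp [hval, hji]⟩
    · rintro ⟨j, hj, rfl⟩
      rw [hval]
      split_ifs with hji
      · refine ⟨fun he => ?_, k, by omega, rfl⟩
        have := hinj _ le_rfl _ hi he; omega
      · refine ⟨fun he => ?_, j, by omega, rfl⟩
        have := hinj _ hj.le _ hi he; omega

theorem ert_phase_le {D : WalkData} {k : ℕ} {R : Finset ℕ} {X : State → ℝ≥0∞} {B : ℝ≥0∞}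
    (hX : ∀ s' R', D.Mem k R' s' →
      MatchingState D.n D.E (s'.iarr 3) (s'.iarr 2) (R' : Set ℕ) → (∀ u ∈ R', u < D.n) → X s' ≤ B)
    {s : State} (hM : D.Mem (k + 1) R s) (hk : k + 1 ≤ D.n) (hR : ∀ u ∈ R, u < D.n)
    (hm : MatchingState D.n D.E (s.iarr 3) (s.iarr 2) (R : Set ℕ)) :
    ert phase X s ≤ D.cost + 30 + D.cost * (D.n / ((k + 1 : ℕ) : ℝ≥0∞)) + B := by
  obtain ⟨m, hmdef⟩ : ∃ m, m = D.ptr D.n := ⟨_, rfl⟩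
  obtain ⟨mate, hmate⟩ : ∃ mate, mate = s.iarr 3 := ⟨_, rfl⟩
  obtain ⟨out, hout⟩ : ∃ out, out = s.iarr 2 := ⟨_, rfl⟩
  rw [← hmate, ← hout] at hm
  rw [phase]
  simp only [ert_seq, ert_iset, IExp.eval, ivar_setIVar, hM.ivar1, hM.ivar2, ← hmdef]
  norm_num
  have hsample := ert_sample_le
    (f := ert (.seq (.iset 9 (.get 1 (.var 3)))
    (.seq (.iset 2 (.sub (.var 2) (.lit 1)))
    (.seq (.iput 1 (.var 3) (.get 1 (.add (.var 1) (.var 2))))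
    (.seq (.iset 8 (.var 9))
    (.seq (.iset 11 (.lit 1))
    (.seq walk
    (.seq (.iset 8 (.var 9))
    (.seq (.iset 11 (.lit 1))
      augment)))))))) X)
    (s := (s.setIVar 3 m).setIVar 4 (m + (k + 1)))
    (F := fun e => D.cost * walkTime D.n D.W mate (s.iarr 1 e) + (28 + B))
    (l := m) (r := m + (k + 1)) (by simp) (by simp) (by omega)
    (by
      simp only [rarr_setIVar, hM.rarr1]
      exact D.strictMonoOn.mono (Set.Icc_subset_Icc (Nat.zero_le _) (by omega))) ?_
  · simp only [rarr_setIVar, hM.rarr1] at hsample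
    have hS : ∀ i ≤ D.n, D.S (m + i) = D.S m + i := fun i hi => hmdef ▸ D.tail i hi
    have hsum : ∑ e ∈ Finset.Ico m (m + (k + 1)),
        ENNReal.ofReal ((D.S (e + 1) - D.S e) / (D.S (m + (k + 1)) - D.S m)) *
          (D.cost * walkTime D.n D.W mate (s.iarr 1 e) + (28 + B)) ≤
        D.cost * (D.n / ((k + 1 : ℕ) : ℝ≥0∞)) + (28 + B) := by
      rw [Finset.sum_Ico_eq_sum_range, Nat.add_sub_cancel_left]
      -- Past the adjacency arrays all increments are one, so the sampled row is uniform.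
      have hw : ∀ i ∈ Finset.range (k + 1), ENNReal.ofReal ((D.S (m + i + 1) - D.S (m + i)) /
          (D.S (m + (k + 1)) - D.S m)) = ((k + 1 : ℕ) : ℝ≥0∞)⁻¹ := by
        intro i hi
        have hi := Finset.mem_range.1 hi
        rw [add_assoc, hS (i + 1) (by omega), hS i (by omega), hS (k + 1) hk,
          ← ENNReal.ofReal_natCast (k + 1), ← ENNReal.ofReal_inv_of_pos (by positivity)]
        congr 1
        push_cast
        rw [add_sub_add_left_eq_sub, add_sub_cancel_left, add_sub_cancel_left, one_div]
      rw [Finset.sum_congr rfl fun i hi => by rw [hw i hi], ← Finset.mul_sum,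
        Finset.sum_add_distrib, ← Finset.mul_sum]
      have himg : R = (Finset.range (k + 1)).image fun i => s.iarr 1 (m + i) := by
        ext u
        rw [hM.mem_iff, Finset.mem_image, hmdef]
        simp
      have hwalk : ∑ i ∈ Finset.range (k + 1), walkTime D.n D.W mate (s.iarr 1 (m + i)) ≤ D.n := by
        have h1 := sum_walkTime_le D.W_ne_top D.W_col hm.matching R
          fun u hu => ⟨hR u hu, (hm.unmatched_iff u (hR u hu)).2 hu⟩
        rw [himg, Finset.sum_image] at h1
        · exact h1
        · intro a ha b hb hab
          refine hM.injOn (by simpa using ha) (by simpa using hb) ?_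
          rwa [← hmdef]
      rw [Finset.sum_const, Finset.card_range, nsmul_eq_mul, mul_add, ← mul_assoc _ _ (28 + B),
        ENNReal.inv_mul_cancel (by simp) (by simp), one_mul, ENNReal.div_eq_inv_mul,
        mul_left_comm]
      gcongr
    have hc : (Nat.clog 2 (m + (k + 1) - m) : ℝ≥0∞) ≤ Nat.clog 2 D.n := by
      rw [Nat.add_sub_cancel_left]
      exact_mod_cast Nat.clog_mono_right 2 hk
    rw [show ∀ x : ℝ≥0∞, 1 + (1 + (1 + (1 + (1 + x)))) = 5 + x by intro x; ring]
    calc _ ≤ 5 + (34 * (Nat.clog 2 D.n : ℝ≥0∞) + 1 +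
          (D.cost * (D.n / ((k + 1 : ℕ) : ℝ≥0∞)) + (28 + B))) :=
          add_le_add le_rfl (hsample.trans
            (add_le_add (add_le_add (mul_le_mul_right hc _) le_rfl) hsum))
      -- The twenty extra steps only round the constant up to `D.cost + 30`.
      _ ≤ 5 + (34 * (Nat.clog 2 D.n : ℝ≥0∞) + 1 +
          (D.cost * (D.n / ((k + 1 : ℕ) : ℝ≥0∞)) + (28 + B))) + 20 := le_self_add
      _ = D.cost + 30 + D.cost * (D.n / ((k + 1 : ℕ) : ℝ≥0∞)) + B := by
          rw [show D.cost + 30 = 34 * (Nat.clog 2 D.n : ℝ≥0∞) + 24 + 30 by rw [WalkData.cost]]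
          ring
      _ ≤ _ := by simp
  · intro s' e hA he h3'
    obtain ⟨i, rfl⟩ := Nat.exists_eq_add_of_le he.1
    have hi : i ≤ k := by have := he.2; omega
    obtain ⟨u, hu⟩ : ∃ u, u = s.iarr 1 (m + i) := ⟨_, rfl⟩
    have huR : u ∈ R := (hM.mem_iff u).2 ⟨i, by omega, by rw [hu, hmdef]⟩
    have hun := hR u huR
    have v0 : s'.ivar 0 = s.ivar 0 := by rw [hA.ivar 0 (by simp)]; simp
    have v1 : s'.ivar 1 = m := by rw [hA.ivar 1 (by simp)]; simp [hM.ivar1, hmdef]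
    have v2 : s'.ivar 2 = k + 1 := by rw [hA.ivar 2 (by simp)]; simp [hM.ivar2]
    have ha : s'.iarr = s.iarr := by rw [hA.iarr]; simp
    have hr : s'.rarr = s.rarr := by rw [hA.rarr]; simp
    simp only [ert_seq, ert_iset, ert_iput, IExp.eval, ivar_setIVar, ivar_setIArr, iarr_setIVar,
      h3', v1, v2, ha, ← hu]
    norm_num
    rw [show ∀ x : ℝ≥0∞, 1 + (1 + (1 + (1 + (1 + (1 + (1 + (1 + (1 + (1 + (1 + x)))))))))) = 11 + x by
      intro x; ring]
    set s₁ := ((((s'.setIVar 9 u).setIVar 2 k).setIArr 1 (m + i) (s.iarr 1 (m + k))).setIVar 8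
      u).setIVar 11 1 with hs₁
    have hM₁ : D.Mem k (R.erase u) s₁ := by
      have := hM.remove (s' := s₁) hi (by simp [hs₁, v0])
        (by simp [hs₁, v1, hM.ivar1, hmdef]) (by simp [hs₁]) (by simp [hs₁, ha])
        (by simp [hs₁, ha, ← hmdef]) (by simp [hs₁, hr])
      rwa [← hmdef, ← hu] at this
    have hm₁ : MatchingState D.n D.E mate out (insert u ((R.erase u : Finset ℕ) : Set ℕ)) := by
      rwa [← Finset.coe_insert, Finset.insert_erase huR]
    have hwalk := ert_walk_le (X := ert (.seq (.iset 8 (.var 9)) (.seq (.iset 11 (.lit 1))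
      augment)) X) (B := 5 + B) hm₁ ?_ hM₁ (by simp [hs₁, ha, hmate]) (by simp [hs₁, ha, hout]) hun
      (by simp [hs₁]) (by simp [hs₁]) (by simp [hs₁])
    · calc _ ≤ 11 + (D.cost * walkTime D.n D.W mate u + (11 + (5 + B))) :=
            add_le_add le_rfl hwalk
        _ ≤ 11 + (D.cost * walkTime D.n D.W mate u + (11 + (5 + B))) + 1 := le_self_add
        _ = _ := by ring
    · intro t L hMt ht3 ht2 ht9 hnd hp
      simp only [ert_seq, ert_iset, IExp.eval, ht9]
      have haug := ert_augment_le (D := D) (k := k) (R := R.erase u) (X := X) (B := B)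
        (s := (t.setIVar 8 u).setIVar 11 1) (u := u) (L := L)
        (fun s' h h' => hX s' _ h h' fun v hv => hR v (Finset.mem_of_mem_erase hv))
        (hMt.congr (by simp) (by simp) (by simp) (by simp) (by simp) (by simp))
        (by simpa [ht3, ht2] using hm₁) hun (by simp) (by simp) (by simp) hnd
        (by simpa [ht3] using hp)
      calc _ ≤ 1 + (1 + (1 + (1 + (10 * ((u :: L).length : ℝ≥0∞) + 1 + B)))) := by
            gcongr
        _ = _ := by ring
end RandRAM

/-! ### The matching phase and its total time -/

namespace RandRAM

/-- The matching phase. -/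
def matchingPhase : Cmd := .seq (.iset 2 (.var 0)) (.loop (.ilt (.lit 0) (.var 2)) phase)

/-- A bound for the expected time of the matching phase. -/
noncomputable def WalkData.time (D : WalkData) (k : ℕ) : ℝ≥0∞ :=
  ∑ j ∈ Finset.range k, (31 + D.cost + D.cost * (D.n / ((j + 1 : ℕ) : ℝ≥0∞)))

/-- The array `out` maps the rows injectively to adjacent columns. -/
def WalkData.Solution (D : WalkData) (out : ℕ → ℕ) : Prop :=
  Set.InjOn out (Set.Iio D.n) ∧ ∀ u < D.n, out u < D.n ∧ D.E u (out u)

/-- Every row is matched, and `mate` is a left inverse of `out` up to the shift by one, whence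
injectivity. -/
theorem WalkData.solution_of_matchingState {D : WalkData} {mate out : ℕ → ℕ}
    (h : MatchingState D.n D.E mate out ∅) : D.Solution out := by
  have key : ∀ u < D.n, out u < D.n ∧ D.E u (out u) ∧ mate (out u) = u + 1 := by
    intro u hu
    have h1 : ¬ Unmatched D.n mate u := fun h' => (h.unmatched_iff u hu).1 h'
    simp only [Unmatched, not_forall, not_not] at h1
    obtain ⟨v, hv, hm⟩ := h1
    obtain ⟨-, hE, rfl⟩ := h.matching v hv u hm
    exact ⟨hv, hE, hm⟩
  refine ⟨fun a ha b hb hab => ?_, fun u hu => ⟨(key u hu).1, (key u hu).2.1⟩⟩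
  have h1 := (key a ha).2.2
  rw [hab, (key b hb).2.2] at h1
  omega

theorem ert_matchingPhase_le {D : WalkData} {s : State}
    (hM : D.Mem D.n (Finset.range D.n) (s.setIVar 2 D.n)) (h3 : s.iarr 3 = 0) :
    ert matchingPhase (require fun s' => D.Solution (s'.iarr 2)) s ≤ 3 + D.time D.n := by
  have h0 : s.ivar 0 = D.n := by simpa using hM.ivar0
  rw [matchingPhase]
  simp only [ert_seq, ert_iset, IExp.eval, h0]
  let Inv : ℕ → State → Prop := fun k s => k ≤ D.n ∧ ∃ R, D.Mem k R s ∧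
    MatchingState D.n D.E (s.iarr 3) (s.iarr 2) (R : Set ℕ) ∧ ∀ u ∈ R, u < D.n
  have key : ert (.loop (.ilt (.lit 0) (.var 2)) phase)
      (require fun s' => D.Solution (s'.iarr 2)) (s.setIVar 2 D.n) ≤ 1 + D.time D.n := by
    refine ert_loop_le Inv (fun k => 1 + D.time k) ?_ ?_
      ⟨le_rfl, Finset.range D.n, hM, ⟨?_, ?_⟩, by simp⟩
    · rintro k s ⟨hk, R, hM, hm, hR⟩ hb X hX
      simp only [Test.Holds, IExp.eval, hM.ivar2] at hb
      obtain ⟨k, rfl⟩ := Nat.exists_eq_succ_of_ne_zero hb.ne'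
      refine (add_le_add le_rfl (ert_phase_le (B := 1 + D.time k) (fun s' R' hM' hm' hR' =>
        hX k s' ⟨by omega, R', hM', hm', hR'⟩) hM hk hR hm)).trans (le_of_eq ?_)
      rw [WalkData.time, WalkData.time, Finset.sum_range_succ,
        show (31 : ℝ≥0∞) = 30 + 1 by norm_num]
      ring
    · rintro k s ⟨hk, R, hM, hm, hR⟩ hb
      simp only [Test.Holds, IExp.eval, hM.ivar2, not_lt, Nat.le_zero] at hb
      subst hb
      have hR0 : R = ∅ := by
        ext u
        simp [hM.mem_iff]
      rw [hR0, Finset.coe_empty] at hm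
      rw [require_of (WalkData.solution_of_matchingState hm)]
      simp
    · intro v hv u hu
      simp [h3] at hu
    · intro u hu
      simp [Unmatched, h3, hu]
  calc _ ≤ 1 + (1 + (1 + D.time D.n)) := by gcongr
    _ = 3 + D.time D.n := by ring

theorem natClog_two_le (n : ℕ) (hn : 2 ≤ n) : (Nat.clog 2 n : ℝ) ≤ 3 * Real.log n := by
  have h1 : 2 ^ (Nat.clog 2 n).pred < n := Nat.pow_pred_clog_lt_self one_lt_two (by omega)
  have h2 : ((Nat.clog 2 n).pred : ℝ) * Real.log 2 ≤ Real.log n := by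
    rw [← Real.log_pow]
    exact Real.log_le_log (by positivity) (by exact_mod_cast h1.le)
  have h3 : Real.log 2 ≤ Real.log n := Real.log_le_log (by norm_num) (by exact_mod_cast hn)
  have h4 := Real.log_two_gt_d9
  have h5 : (Nat.clog 2 n : ℝ) ≤ (Nat.clog 2 n).pred + 1 := by
    exact_mod_cast (by rw [Nat.pred_eq_sub_one]; omega : Nat.clog 2 n ≤ (Nat.clog 2 n).pred + 1)
  nlinarith [Nat.cast_nonneg (α := ℝ) (Nat.clog 2 n).pred]

theorem WalkData.time_le (D : WalkData) :
    3 + D.time D.n ≤ ENNReal.ofReal (1000 * (D.n * Real.log D.n ^ 2 + 1)) := by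
  set c : ℝ := 34 * Nat.clog 2 D.n + 24 with hc
  have hc0 : 0 ≤ c := by positivity
  have hcost : D.cost = ENNReal.ofReal c := by
    rw [hc, WalkData.cost, ENNReal.ofReal_add (by positivity) (by norm_num),
      ENNReal.ofReal_mul (by norm_num)]
    simp
  have hsum : 3 + D.time D.n = ENNReal.ofReal
      (3 + ∑ j ∈ Finset.range D.n, (31 + c + c * (D.n / ((j + 1 : ℕ) : ℝ)))) := by
    rw [ENNReal.ofReal_add (by norm_num) (Finset.sum_nonneg fun j _ => by positivity),
      ENNReal.ofReal_sum_of_nonneg fun j _ => by positivity]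
    congr 1
    · simp
    · refine Finset.sum_congr rfl fun j _ => ?_
      rw [ENNReal.ofReal_add (by positivity) (by positivity),
        ENNReal.ofReal_add (by norm_num) hc0, ENNReal.ofReal_mul hc0,
        ENNReal.ofReal_div_of_pos (by positivity), hcost, ENNReal.ofReal_natCast,
        ENNReal.ofReal_natCast]
      simp
  rw [hsum]
  refine ENNReal.ofReal_le_ofReal ?_
  have hharm : ∑ j ∈ Finset.range D.n, (D.n / ((j + 1 : ℕ) : ℝ)) ≤ D.n * (1 + Real.log D.n) := by
    have h := harmonic_le_one_add_log D.n
    rw [harmonic] at h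
    push_cast at h
    simp only [div_eq_mul_inv]
    rw [← Finset.mul_sum]
    push_cast
    gcongr
  rw [Finset.sum_add_distrib, ← Finset.mul_sum, Finset.sum_const, Finset.card_range, nsmul_eq_mul]
  have hle := mul_le_mul_of_nonneg_left hharm hc0
  -- For `n ≤ 1` the term with the logarithm vanishes and the summand `1` pays. For `n ≥ 2` the
  -- inequality `1 ≤ 3 / 2 * log n` absorbs lower-order terms into the square.
  rcases Nat.lt_or_ge D.n 2 with hn | hn
  · interval_cases h : D.n
    · simp at hle ⊢
      linarith
    · simp [hc] at hle ⊢
      linarith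
  · have h1 := natClog_two_le D.n hn
    have h3 : Real.log 2 ≤ Real.log D.n := Real.log_le_log (by norm_num) (by exact_mod_cast hn)
    have h4 := Real.log_two_gt_d9
    set l := Real.log D.n
    have hl : 1 ≤ 3 / 2 * l := by linarith
    have hcl : c ≤ 138 * l := by rw [hc]; linarith
    have hn0 : (0 : ℝ) ≤ D.n := Nat.cast_nonneg _
    have hll : l ≤ 3 / 2 * l ^ 2 := by nlinarith
    have h31 : (31 : ℝ) + c ≤ 300 * l ^ 2 := by nlinarith
    have hcl2 : c * (1 + l) ≤ 500 * l ^ 2 := by nlinarith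
    have e1 := mul_le_mul_of_nonneg_left h31 hn0
    have e2 := mul_le_mul_of_nonneg_left hcl2 hn0
    have e3 : 0 ≤ (D.n : ℝ) * l ^ 2 := by positivity
    linarith

/-! ### Preprocessing -/

/-- Compute the prefix sums of the entries. -/
def sumEntries : Cmd :=
  .loop (.ilt (.var 2) (.var 1))
    (.seq (.rput 1 (.add (.var 2) (.lit 1)) (.add (.get 1 (.var 2)) (.get 0 (.var 2))))
      (.iset 2 (.add (.var 2) (.lit 1))))

/-- List the rows after the adjacency arrays, with increments one of the prefix sums. -/
def listRows : Cmd :=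
  .loop (.ilt (.var 8) (.var 0))
    (.seq (.iput 1 (.add (.var 1) (.var 8)) (.var 8))
    (.seq (.rput 1 (.add (.add (.var 1) (.var 8)) (.lit 1))
        (.add (.get 1 (.add (.var 1) (.var 8))) .one))
      (.iset 8 (.add (.var 8) (.lit 1)))))

/-- The preprocessing phase. -/
def preprocessing : Cmd := .seq (.iset 1 (.get 0 (.var 0))) (.seq sumEntries listRows)

/-- The prefix sums of the weights `wt` of the first `m` positions and of weight one afterwards. -/
noncomputable def prefixSum (m : ℕ) (wt : ℕ → ℝ) (e : ℕ) : ℝ :=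
  ∑ i ∈ Finset.range e, if i < m then wt i else 1

/-- The memory after preprocessing. -/
structure Preprocessed (n : ℕ) (ptr col : ℕ → ℕ) (wt : ℕ → ℝ) (s : State) : Prop where
  ivar0 : s.ivar 0 = n
  ivar1 : s.ivar 1 = ptr n
  iarr0 : s.iarr 0 = ptr
  iarr1 : ∀ e < ptr n, s.iarr 1 e = col e
  list : ∀ i < n, s.iarr 1 (ptr n + i) = i
  iarr3 : s.iarr 3 = 0
  rarr1 : ∀ e ≤ ptr n + n, s.rarr 1 e = prefixSum (ptr n) wt e

theorem prefixSum_succ (m : ℕ) (wt : ℕ → ℝ) (e : ℕ) :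
    prefixSum m wt (e + 1) = prefixSum m wt e + if e < m then wt e else 1 :=
  Finset.sum_range_succ _ _

theorem ert_preprocessing_le (n : ℕ) (ptr col : ℕ → ℕ) (wt : ℕ → ℝ) :
    ert preprocessing (require (Preprocessed n ptr col wt)) (inputState n ptr col wt) ≤
      ((5 + 4 * ptr n + 6 * n : ℕ) : ℝ≥0∞) := by
  obtain ⟨m, hm⟩ : ∃ m, m = ptr n := ⟨_, rfl⟩
  let Inv₁ : ℕ → State → Prop := fun d s => s.ivar 0 = n ∧ s.ivar 1 = m ∧ s.ivar 8 = 0 ∧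
    s.iarr 0 = ptr ∧ s.iarr 1 = col ∧ s.iarr 3 = 0 ∧ s.rarr 0 = wt ∧ s.ivar 2 + d = m ∧
    ∀ e ≤ s.ivar 2, s.rarr 1 e = prefixSum m wt e
  let Inv₂ : ℕ → State → Prop := fun d s => s.ivar 0 = n ∧ s.ivar 1 = m ∧
    s.iarr 0 = ptr ∧ (∀ e < m, s.iarr 1 e = col e) ∧ s.iarr 3 = 0 ∧ s.ivar 8 + d = n ∧
    (∀ i < s.ivar 8, s.iarr 1 (m + i) = i) ∧
    ∀ e ≤ m + s.ivar 8, s.rarr 1 e = prefixSum m wt e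
  have h₂ : ∀ s, Inv₂ n s → ert listRows (require (Preprocessed n ptr col wt)) s ≤ 6 * n + 1 := by
    intro s hs
    refine ert_loop_le Inv₂ (fun d => 6 * (d : ℝ≥0∞) + 1) ?_ ?_ hs
    · rintro d s ⟨h0, h1, i0, i1, i3, hd, hl, hr⟩ hb X hX
      simp only [Test.Holds, IExp.eval, h0] at hb
      obtain ⟨d, rfl⟩ : ∃ d', d = d' + 1 := ⟨d - 1, by omega⟩
      simp only [ert_seq, ert_iput, ert_rput, ert_iset, IExp.eval, RExp.eval, h1, ivar_setIArr,
        ivar_setRArr, rarr_setIArr]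
      obtain ⟨j, hj⟩ : ∃ j, j = s.ivar 8 := ⟨_, rfl⟩
      simp only [← hj] at hb hd hl hr ⊢
      rw [show ∀ x : ℝ≥0∞, 1 + (1 + (1 + (1 + (1 + (1 + x))))) = 6 + x by intro x; ring,
        show 6 * ((d + 1 : ℕ) : ℝ≥0∞) + 1 = 6 + (6 * d + 1) by push_cast; ring]
      refine add_le_add le_rfl (hX d _ ⟨by simp [h0], by simp [h1], by simp [i0], ?_, by simp [i3],
        by simp; omega, ?_, ?_⟩)
      · intro e he
        simp [Function.update_of_ne (show e ≠ m + j by omega), i1 e he]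
      · intro i hi
        simp only [ivar_setIVar, if_true] at hi
        by_cases hij : i = j
        · simp [hij]
        · simp [Function.update_of_ne (show m + i ≠ m + j by omega), hl i (by omega)]
      · intro e he
        simp only [ivar_setIVar, if_true] at he
        by_cases hej : e = m + j + 1
        · subst hej
          simp [prefixSum_succ, hr (m + j) le_rfl]
        · simp [Function.update_of_ne hej, hr e (by omega)]
    · rintro d s ⟨h0, h1, i0, i1, i3, hd, hl, hr⟩ hb
      simp only [Test.Holds, IExp.eval, h0] at hb
      have h8 : s.ivar 8 = n := by omega
      rw [require_of]
      · simp
      · subst hm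
        exact ⟨h0, h1, i0, i1, h8 ▸ hl, i3, h8 ▸ hr⟩
  have h₁ : ∀ s, Inv₁ m s → ert sumEntries (ert listRows (require (Preprocessed n ptr col wt))) s ≤
      4 * m + (6 * n + 2) := by
    intro s hs
    refine ert_loop_le Inv₁ (fun d => 4 * (d : ℝ≥0∞) + (6 * n + 2)) ?_ ?_ hs
    · rintro d s ⟨h0, h1, h8, i0, i1, i3, r0, hd, hr⟩ hb X hX
      simp only [Test.Holds, IExp.eval, h1] at hb
      obtain ⟨d, rfl⟩ : ∃ d', d = d' + 1 := ⟨d - 1, by omega⟩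
      simp only [ert_seq, ert_rput, ert_iset, IExp.eval, RExp.eval, ivar_setRArr]
      obtain ⟨j, hj⟩ : ∃ j, j = s.ivar 2 := ⟨_, rfl⟩
      simp only [← hj] at hb hd hr ⊢
      rw [show ∀ x : ℝ≥0∞, 1 + (1 + (1 + (1 + x))) = 4 + x by intro x; ring,
        show 4 * ((d + 1 : ℕ) : ℝ≥0∞) + (6 * n + 2) = 4 + (4 * d + (6 * n + 2)) by push_cast; ring]
      refine add_le_add le_rfl (hX d _ ⟨by simp [h0], by simp [h1], by simp [h8], by simp [i0],
        by simp [i1], by simp [i3], by simp [r0], by simp; omega, ?_⟩)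
      intro e he
      simp only [ivar_setIVar, if_true] at he
      by_cases hej : e = j + 1
      · subst hej
        simp [prefixSum_succ, hr j le_rfl, r0, hb]
      · simp [Function.update_of_ne hej, hr e (by omega)]
    · rintro d s ⟨h0, h1, h8, i0, i1, i3, r0, hd, hr⟩ hb
      simp only [Test.Holds, IExp.eval, h1] at hb
      have h2 : s.ivar 2 = m := by omega
      refine (add_le_add le_rfl (h₂ s ⟨h0, h1, i0, fun e _ => by rw [i1], i3, by omega,
        by simp [h8], by rw [h8]; exact h2 ▸ hr⟩)).trans ?_
      calc (1 : ℝ≥0∞) + (6 * n + 1) = 6 * n + 2 := by ring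
        _ ≤ _ := le_add_self
  rw [preprocessing]
  simp only [ert_seq, ert_iset, IExp.eval]
  refine (add_le_add le_rfl (add_le_add le_rfl (add_le_add le_rfl (h₁ _ ?_)))).trans (le_of_eq ?_)
  · refine ⟨by simp [inputState], by simp [inputState, hm], by simp [inputState],
      by simp [inputState], by simp [inputState], by simp [inputState], by simp [inputState],
      by simp [inputState], ?_⟩
    intro e he
    simp only [inputState, ivar_setIVar] at he
    norm_num at he
    subst he
    simp [inputState, prefixSum]
  · push_cast [← hm]
    ring

theorem noFlip_preprocessing : preprocessing.NoFlip := by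
  simp [preprocessing, sumEntries, listRows, Cmd.NoFlip]

/-! ### From doubly stochastic matrices to walk data -/

theorem exists_row_of_lt {ptr : ℕ → ℕ} (h0 : ptr 0 = 0) {n e : ℕ} (he : e < ptr n) :
    ∃ u < n, ptr u ≤ e ∧ e < ptr (u + 1) := by
  induction n with
  | zero => omega
  | succ n ih =>
    by_cases h : e < ptr n
    · obtain ⟨u, hu, h'⟩ := ih h
      exact ⟨u, by omega, h'⟩
    · exact ⟨n, by omega, by omega, he⟩

theorem monotone_ptr {ptr : ℕ → ℕ} {n : ℕ} (h : ∀ i < n, ptr i ≤ ptr (i + 1)) {u v : ℕ}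
    (huv : u ≤ v) (hv : v ≤ n) : ptr u ≤ ptr v := by
  induction v, huv using Nat.le_induction with
  | base => exact le_rfl
  | succ v huv ih => exact (ih (by omega)).trans (h v (by omega))

/-- The entries of a matrix, indexed by natural numbers. -/
noncomputable def natEntry {n : ℕ} (M : Matrix (Fin n) (Fin n) ℝ) (u v : ℕ) : ℝ≥0∞ :=
  if h : u < n ∧ v < n then ENNReal.ofReal (M ⟨u, h.1⟩ ⟨v, h.2⟩) else 0

theorem natEntry_fin {n : ℕ} (M : Matrix (Fin n) (Fin n) ℝ) (i j : Fin n) :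
    natEntry M i j = ENNReal.ofReal (M i j) := by simp [natEntry]

theorem prefixSum_add_of_le {m : ℕ} {wt : ℕ → ℝ} (i : ℕ) :
    prefixSum m wt (m + i) = prefixSum m wt m + i := by
  induction i with
  | zero => simp
  | succ i ih =>
    rw [← add_assoc, prefixSum_succ, ih]
    simp [add_assoc]

section
variable {n : ℕ} {M : Matrix (Fin n) (Fin n) ℝ} {ptr col : ℕ → ℕ} {wt : ℕ → ℝ}

theorem sum_natEntry_row (hM : M ∈ doublyStochastic ℝ (Fin n)) {u : ℕ} (hu : u < n) :
    ∑ v ∈ Finset.range n, natEntry M u v = 1 := by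
  rw [mem_doublyStochastic_iff_sum] at hM
  rw [Finset.sum_range]
  simp only [natEntry_fin M ⟨u, hu⟩]
  rw [← ENNReal.ofReal_sum_of_nonneg fun j _ => hM.1 _ j, hM.2.1, ENNReal.ofReal_one]

theorem sum_natEntry_col (hM : M ∈ doublyStochastic ℝ (Fin n)) {v : ℕ} (hv : v < n) :
    ∑ u ∈ Finset.range n, natEntry M u v = 1 := by
  rw [mem_doublyStochastic_iff_sum] at hM
  rw [Finset.sum_range]
  simp only [fun i => natEntry_fin M i ⟨v, hv⟩]
  rw [← ENNReal.ofReal_sum_of_nonneg fun i _ => hM.1 i _, hM.2.2, ENNReal.ofReal_one]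

/-- Along row `u` the array `col` is injective and reaches every column with a nonzero entry; the
other columns contribute zero. -/
theorem sum_row_eq (hA : IsAdjacencyArray M ptr col wt) {u : ℕ} (hu : u < n) (F : ℕ → ℝ≥0∞) :
    ∑ e ∈ Finset.Ico (ptr u) (ptr (u + 1)), ENNReal.ofReal (wt e) * F (col e) =
      ∑ v ∈ Finset.range n, natEntry M u v * F v := by
  classical
  have hinj : Set.InjOn col (Finset.Ico (ptr u) (ptr (u + 1)) : Finset ℕ) := by
    rw [Finset.coe_Ico]
    exact hA.injOn ⟨u, hu⟩
  have hentry := hA.entry ⟨u, hu⟩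
  have h1 : ∀ e ∈ Finset.Ico (ptr u) (ptr (u + 1)),
      ENNReal.ofReal (wt e) * F (col e) = natEntry M u (col e) * F (col e) := by
    intro e he
    obtain ⟨j, hj, -, hw⟩ := hentry e (by simpa using he)
    rw [hj, hw, natEntry_fin M ⟨u, hu⟩ j]
  rw [Finset.sum_congr rfl h1, ← Finset.sum_image (f := fun v => natEntry M u v * F v) hinj]
  refine Finset.sum_subset ?_ ?_
  · intro v hv
    obtain ⟨e, he, rfl⟩ := Finset.mem_image.1 hv
    obtain ⟨j, hj, -⟩ := hentry e (by simpa using he)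
    rw [hj, Finset.mem_range]
    exact j.2
  · intro v hv hv'
    have hv := Finset.mem_range.1 hv
    have : M ⟨u, hu⟩ ⟨v, hv⟩ = 0 := by
      by_contra h
      obtain ⟨e, he, hce⟩ := hA.complete ⟨u, hu⟩ ⟨v, hv⟩ h
      exact hv' (Finset.mem_image.2 ⟨e, by simpa using he, hce⟩)
    simp [natEntry, hu, hv, this]

theorem wt_pos (hM : M ∈ doublyStochastic ℝ (Fin n)) (hA : IsAdjacencyArray M ptr col wt) {e : ℕ}
    (he : e < ptr n) : 0 < wt e := by
  rw [mem_doublyStochastic_iff_sum] at hM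
  obtain ⟨u, hu, h1, h2⟩ := exists_row_of_lt hA.ptr_zero he
  obtain ⟨j, -, h0, hw⟩ := hA.entry ⟨u, hu⟩ e ⟨h1, h2⟩
  rw [hw]
  exact lt_of_le_of_ne (hM.1 _ _) h0.symm

theorem sum_wt_row (hM : M ∈ doublyStochastic ℝ (Fin n)) (hA : IsAdjacencyArray M ptr col wt)
    {u : ℕ} (hu : u < n) : ∑ e ∈ Finset.Ico (ptr u) (ptr (u + 1)), wt e = 1 := by
  have h := sum_row_eq hA hu fun _ => 1
  simp only [mul_one, sum_natEntry_row hM hu] at h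
  rw [← ENNReal.ofReal_sum_of_nonneg, ENNReal.ofReal_eq_one] at h
  · exact h
  · intro e he
    have := monotone_ptr hA.ptr_le (show u + 1 ≤ n from hu) le_rfl
    exact (wt_pos hM hA (by have := (Finset.mem_Ico.1 he).2; omega)).le

theorem ptr_lt_succ (hM : M ∈ doublyStochastic ℝ (Fin n)) (hA : IsAdjacencyArray M ptr col wt)
    {u : ℕ} (hu : u < n) : ptr u < ptr (u + 1) := by
  by_contra h
  have := sum_wt_row hM hA hu
  rw [Finset.Ico_eq_empty h] at this
  simp at this

/-- Rows sum to one, so none is empty. This makes the `O(n)` part of the preprocessing linear in the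
number of entries. -/
theorem le_ptr (hM : M ∈ doublyStochastic ℝ (Fin n)) (hA : IsAdjacencyArray M ptr col wt)
    {u : ℕ} (hu : u ≤ n) : u ≤ ptr u := by
  induction u with
  | zero => simp
  | succ u ih =>
    have := ptr_lt_succ hM hA (show u < n from hu)
    have := ih (by omega)
    omega

theorem ptr_le_numNonzero (hA : IsAdjacencyArray M ptr col wt) : ptr n ≤ numNonzero M := by
  classical
  have hrow : ∀ e : Fin (ptr n), ∃ p : Fin n × Fin n, M p.1 p.2 ≠ 0 ∧ col e = p.2 ∧
      (e : ℕ) ∈ Set.Ico (ptr p.1) (ptr (p.1 + 1)) := by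
    intro e
    obtain ⟨u, hu, he⟩ := exists_row_of_lt hA.ptr_zero e.2
    obtain ⟨j, hj, h0, -⟩ := hA.entry ⟨u, hu⟩ e he
    exact ⟨(⟨u, hu⟩, j), h0, hj, he⟩
  choose f hf using hrow
  have hinj : Function.Injective f := by
    intro a b hab
    have ha := hf a
    have hb := hf b
    rw [← hab] at hb
    exact Fin.ext (hA.injOn _ ha.2.2 hb.2.2 (ha.2.1.trans hb.2.1.symm))
  calc ptr n = (Set.range f).ncard := by
        rw [← Set.image_univ, Set.ncard_image_of_injective _ hinj, Set.ncard_univ]; simp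
    _ ≤ _ := Set.ncard_le_ncard (by rintro _ ⟨e, rfl⟩; exact (hf e).1) (Set.toFinite _)

theorem prefixSum_sub {m a b : ℕ} (hab : a ≤ b) (hb : b ≤ m) :
    prefixSum m wt b - prefixSum m wt a = ∑ e ∈ Finset.Ico a b, wt e := by
  rw [prefixSum, prefixSum, ← Finset.sum_range_add_sum_Ico _ hab, add_sub_cancel_left]
  refine Finset.sum_congr rfl fun e he => ?_
  rw [if_pos]
  have := (Finset.mem_Ico.1 he).2
  omega

theorem strictMono_prefixSum (hM : M ∈ doublyStochastic ℝ (Fin n))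
    (hA : IsAdjacencyArray M ptr col wt) : StrictMono (prefixSum (ptr n) wt) := by
  refine strictMono_nat_of_lt_succ fun e => ?_
  rw [prefixSum_succ]
  split_ifs with h
  · have := wt_pos hM hA h
    linarith
  · linarith

/-- The edges of the support graph, indexed by natural numbers. -/
def natEdge (M : Matrix (Fin n) (Fin n) ℝ) (u v : ℕ) : Prop :=
  ∃ i j : Fin n, u = i ∧ v = j ∧ M i j ≠ 0

/-- The data of the matching phase for a doubly stochastic matrix with prefix sums `S`. -/
noncomputable def walkData (hM : M ∈ doublyStochastic ℝ (Fin n))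
    (hA : IsAdjacencyArray M ptr col wt) (S : ℕ → ℝ)
    (hS : ∀ e ≤ ptr n + n, S e = prefixSum (ptr n) wt e) : WalkData where
  n := n
  ptr := ptr
  col := col
  S := S
  W := natEntry M
  E := natEdge M
  ptr_lt u hu := ptr_lt_succ hM hA hu
  ptr_le u hu := monotone_ptr hA.ptr_le hu le_rfl
  deg_le u hu := by
    have h : (Finset.Ico (ptr u) (ptr (u + 1))).card ≤ (Finset.range n).card := by
      refine Finset.card_le_card_of_injOn col ?_ (by rw [Finset.coe_Ico]; exact hA.injOn ⟨u, hu⟩)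
      intro e he
      obtain ⟨j, hj, -⟩ := hA.entry ⟨u, hu⟩ e (by simpa using he)
      rw [hj]
      simp
    simpa using h
  strictMonoOn := ((strictMono_prefixSum hM hA).strictMonoOn _).congr
    fun e he => (hS e he.2).symm
  row_total u hu := by
    have h1 := monotone_ptr hA.ptr_le (show u + 1 ≤ n from hu) le_rfl
    have h2 := hA.ptr_le u hu
    rw [hS _ (by omega), hS _ (by omega), prefixSum_sub h2 h1, sum_wt_row hM hA hu]
  tail i hi := by rw [hS _ (by omega), hS _ (by omega), prefixSum_add_of_le]
  edge u hu e he := by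
    obtain ⟨j, hj, h0, -⟩ := hA.entry ⟨u, hu⟩ e he
    exact ⟨hj ▸ j.2, ⟨u, hu⟩, j, rfl, hj, h0⟩
  sum_row u hu F := by
    have h1 := monotone_ptr hA.ptr_le (show u + 1 ≤ n from hu) le_rfl
    rw [← sum_row_eq hA hu]
    refine Finset.sum_congr rfl fun e he => ?_
    have he := (Finset.mem_Ico.1 he).2
    rw [hS _ (by omega), hS _ (by omega), prefixSum_sub (by omega) (by omega)]
    simp
  W_ne_top u v := by
    rw [natEntry]
    split_ifs <;> simp
  W_row u hu := sum_natEntry_row hM hu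
  W_col v hv := (sum_natEntry_col hM hv).le

/-- The prefix sums of the data are the actual memory array, since it is known to agree with
`prefixSum` only up to position `ptr n + n`. -/
theorem Preprocessed.mem {s : State} (hM : M ∈ doublyStochastic ℝ (Fin n))
    (hA : IsAdjacencyArray M ptr col wt) (h : Preprocessed n ptr col wt s) :
    (walkData hM hA (s.rarr 1) h.rarr1).Mem n (Finset.range n) (s.setIVar 2 n) where
  ivar0 := h.ivar0
  ivar1 := h.ivar1
  ivar2 := by simp
  iarr0 := h.iarr0
  iarr1 := h.iarr1
  rarr1 := rfl
  injOn a ha b hb hab := by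
    have := h.list a ha
    have := h.list b hb
    simp only [iarr_setIVar, walkData] at hab
    omega
  mem_iff u := by
    rw [Finset.mem_range]
    constructor
    · exact fun hu => ⟨u, hu, h.list u hu⟩
    · rintro ⟨i, hi, rfl⟩
      have := h.list i hi
      simp only [iarr_setIVar, walkData]
      omega

/-- An injective self-map of a finite set is surjective, so every column is covered, and only once.
-/
theorem isPerfectMatchingOf_of_injOn {out : ℕ → ℕ} (hinj : Set.InjOn out (Set.Iio n))
    (h : ∀ u < n, out u < n ∧ natEdge M u (out u)) : IsPerfectMatchingOf M out := by
  have hE : ∀ i j : Fin n, out i = j → M i j ≠ 0 := by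
    intro i j hij
    obtain ⟨i', j', hi, hj, h0⟩ := (h i i.2).2
    obtain rfl : i = i' := Fin.ext hi
    obtain rfl : j = j' := Fin.ext (hij.symm.trans hj)
    exact h0
  let g : Fin n → Fin n := fun i => ⟨out i, (h i i.2).1⟩
  have hg : Function.Injective g := fun a b hab =>
    Fin.ext (hinj a.2 b.2 (congrArg Fin.val hab))
  have hsurj : Function.Surjective g := Finite.injective_iff_surjective.1 hg
  refine ⟨{ verts := Set.univ
            Adj := fun x y => ∃ i j : Fin n, out i = j ∧
              ((x = Sum.inl i ∧ y = Sum.inr j) ∨ (x = Sum.inr j ∧ y = Sum.inl i))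
            adj_sub := ?_
            edge_vert := fun _ => Set.mem_univ _
            symm := ?_ }, ⟨?_, fun x => Set.mem_univ x⟩, ?_⟩
  · rintro x y ⟨i, j, hij, ⟨rfl, rfl⟩ | ⟨rfl, rfl⟩⟩
    · exact ⟨by simp, Or.inl ⟨i, j, rfl, rfl, hE i j hij⟩⟩
    · exact ⟨by simp, Or.inr ⟨i, j, rfl, rfl, hE i j hij⟩⟩
  · constructor
    rintro x y ⟨i, j, hij, hxy⟩
    exact ⟨i, j, hij, hxy.symm.imp And.symm And.symm⟩
  · rintro (i | j) -
    · refine ⟨Sum.inr (g i), ⟨i, g i, rfl, Or.inl ⟨rfl, rfl⟩⟩, ?_⟩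
      rintro y ⟨i', j', hij, ⟨hx, rfl⟩ | ⟨hx, rfl⟩⟩
      · obtain rfl := Sum.inl.inj hx
        exact congrArg _ (Fin.ext hij.symm)
      · cases hx
    · obtain ⟨i, rfl⟩ := hsurj j
      refine ⟨Sum.inl i, ⟨i, g i, rfl, Or.inr ⟨rfl, rfl⟩⟩, ?_⟩
      rintro y ⟨i', j', hij, ⟨hx, rfl⟩ | ⟨hx, rfl⟩⟩
      · cases hx
      · obtain rfl := Sum.inr.inj hx
        exact congrArg _ (hg (Fin.ext hij))
  · intro i j
    constructor
    · rintro ⟨i', j', hij, ⟨hx, hy⟩ | ⟨hx, hy⟩⟩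
      · obtain rfl := Sum.inl.inj hx
        obtain rfl := Sum.inr.inj hy
        exact hij
      · cases hx
    · exact fun hij => ⟨i, j, hij, Or.inl ⟨rfl, rfl⟩⟩

end

end RandRAM

theorem theorem3 :
    ∃ (pre main : RandRAM.Cmd) (C : ℕ),
      ∀ (n : ℕ) (M : Matrix (Fin n) (Fin n) ℝ), M ∈ doublyStochastic ℝ (Fin n) →
      ∀ (ptr col : ℕ → ℕ) (wt : ℕ → ℝ), IsAdjacencyArray M ptr col wt →
      ∀ c ∈ (RandRAM.run (C * (numNonzero M + 1)) ⟨[pre], inputState n ptr col wt⟩).support,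
        c.Halted ∧
        RandRAM.expectedTime ⟨[main], c.state⟩
          ≤ ENNReal.ofReal (C * (n * Real.log n ^ 2 + 1)) ∧
        ∀ t : ℕ, ∀ c' ∈ (RandRAM.run t ⟨[main], c.state⟩).support,
          c'.Halted → IsPerfectMatchingOf M (c'.state.iarr 2) := by
  refine ⟨RandRAM.preprocessing, RandRAM.matchingPhase, 1000, ?_⟩
  intro n M hM ptr col wt hA c hc
  have hpre := RandRAM.ert_preprocessing_le n ptr col wt
  have hle : 5 + 4 * ptr n + 6 * n ≤ 1000 * (numNonzero M + 1) := by
    have := RandRAM.ptr_le_numNonzero hA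
    have := RandRAM.le_ptr hM hA le_rfl
    omega
  -- There are no coin tosses in the preprocessing, so its expected time is a worst-case bound.
  have hhalt : c.Halted := RandRAM.halted_of_noFlip RandRAM.noFlip_preprocessing
    ((RandRAM.expectedTime_le_ert _ _ _).trans (hpre.trans (Nat.cast_le.2 hle))) hc
  have hpost := RandRAM.post_of_ert_lt_top (hpre.trans_lt (ENNReal.natCast_lt_top _)) hc hhalt
  -- This single bound is for the final function that is infinite off solutions; it yields the
  -- expected time and, being finite, the correctness.
  have hmain := (RandRAM.ert_matchingPhase_le (hpost.mem hM hA) hpost.iarr3).trans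
    (RandRAM.WalkData.time_le _)
  refine ⟨hhalt, (RandRAM.expectedTime_le_ert _ _ _).trans (by exact_mod_cast hmain), ?_⟩
  intro t c' hc' hhalt'
  have hsol := RandRAM.post_of_ert_lt_top (hmain.trans_lt ENNReal.ofReal_lt_top) hc' hhalt'
  exact RandRAM.isPerfectMatchingOf_of_injOn hsol.1 hsol.2
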